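/- Let $n\ge 1$ and let $\mathbb{B}^n$ be the open unit ball of $\mathbb{C}^n$. A majorant is a continuous increasing function $\omega:[0,\infty)\to[0,\infty)$ with $\omega(0)=0$ such that $\omega(t)/t$ is non-increasing for $t>0$. For $p\in(0,\infty)$, $r\in(0,1)$ and a function $g$ on $\mathbb{B}^n$ put $$M_p(r,g)=\Big(\int_{\partial\mathbb{B}^n}|g(r\zeta)|^p\,d\sigma(\zeta)\Big)^{1/p},$$ where $\sigma$ is the normalized Lebesgue surface measure on $\partial\mathbb{B}^n$; the generalized Hardy space $\mathcal{H}_g^p(\mathbb{B}^n)$ consists of the measurable functions $f:\mathbb{B}^n\to\mathbb{C}$ for which $M_p(r,f)$ exists for all $r\in(0,1)$ and $\sup_{0<r<1}M_p(r,f)<\infty$. For $f\in\mathcal{C}^2(\mathbb{B}^n)$ (complex-valued, in the real sense) put $$\|D_f\|=\Big[\sum_{k=1}^n\big(|f_{z_k}|^2+|f_{\bar z_k}|^2\big)\Big]^{1/2},\qquad D_f^*=\Big[\sum_{j=1}^n\sum_{k=1}^n\big(|f_{z_kz_j}|^2+|f_{z_k\bar z_j}|^2+|f_{\bar z_kz_j}|^2+|f_{\bar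 z_k\bar z_j}|^2\big)\Big]^{1/2},$$ and write $M_p(r,D_f)$ for $M_p(r,\|D_f\|)$; here $f_{z_k}=\frac12(\partial f/\partial x_k-i\,\partial f/\partial y_k)$ and $f_{\bar z_k}=\frac12(\partial f/\partial x_k+i\,\partial f/\partial y_k)$ with $z_k=x_k+iy_k$. Theorem. Let $p\ge 2$, let $\omega$ be a majorant, and let $\tau,\eta\ge 0$ be constants with $\eta+\tau<4n/p$. Let $f\in\mathcal{C}^2(\mathbb{B}^n)$ satisfy $$\Delta f=\tau f+\eta\,\mathrm{Re}(f)\quad\text{in }\mathbb{B}^n,\qquad \Delta=4\sum_{k=1}^n\frac{\partial^2}{\partial z_k\partial\bar z_k}.$$ Suppose that for some constant $M^*>0$ $$M_p(r,D_f^*)\le M^*\,\omega\Big(\frac1{1-r}\Big)\qquad\text{for all } r\in(0,1).$$ Then, for all $r\in(0,1)$, $$M_p(r,D_f)\le\sqrt{M_2^*}\,\Big[\|D_f(0)\|^2+M_1^*\int_0^1\omega\Big(\frac1{1-rt}\Big)\,dt\Big]^{1/2},$$ where $M_1^*=2p(2p-3)(M^*)^2\,\omega(1)$ and $M_2^*=1/\big[1-p(\eta+\tau)/(4n)\big]$.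 Moreover, $f\in\mathcal{H}_g^p(\mathbb{B}^n)$. -/

import Mathlib

open Set MeasureTheory
open scoped BigOperators

noncomputable section

/-- `ℂⁿ` with its Euclidean norm. -/
abbrev Cn (n : ℕ) : Type := EuclideanSpace ℂ (Fin n)

/-- The open unit ball `𝔹ⁿ` of `ℂⁿ`. -/
def unitBall (n : ℕ) : Set (Cn n) := Metric.ball 0 1

/-- The real partial derivative `∂f/∂x_k`, where `z_k = x_k + i y_k`. -/
def partialX {n : ℕ} (k : Fin n) (f : Cn n → ℂ) (z : Cn n) : ℂ :=
  fderiv ℝ f z (EuclideanSpace.single k (1 : ℂ))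

/-- The real partial derivative `∂f/∂y_k`, where `z_k = x_k + i y_k`. -/
def partialY {n : ℕ} (k : Fin n) (f : Cn n → ℂ) (z : Cn n) : ℂ :=
  fderiv ℝ f z (EuclideanSpace.single k Complex.I)

/-- `f_{z_k} = (1/2) (∂f/∂x_k - i ∂f/∂y_k)`. -/
def partialZ {n : ℕ} (k : Fin n) (f : Cn n → ℂ) (z : Cn n) : ℂ :=
  (1 / 2 : ℂ) * (partialX k f z - Complex.I * partialY k f z)

/-- `f_{\bar z_k} = (1/2) (∂f/∂x_k + i ∂f/∂y_k)`. -/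
def partialZbar {n : ℕ} (k : Fin n) (f : Cn n → ℂ) (z : Cn n) : ℂ :=
  (1 / 2 : ℂ) * (partialX k f z + Complex.I * partialY k f z)

/-- The Hilbert-Schmidt norm `‖D_f(z)‖` of `D_f = (f_{z_1}, …, f_{z_n}, f_{\bar z_1}, …, f_{\bar z_n})`. -/
def normD {n : ℕ} (f : Cn n → ℂ) (z : Cn n) : ℝ :=
  Real.sqrt (∑ k, (‖partialZ k f z‖ ^ 2 + ‖partialZbar k f z‖ ^ 2))

/-- The Hilbert-Schmidt norm `D*_f(z)` of the second order derivatives of `f`. -/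
def normD2 {n : ℕ} (f : Cn n → ℂ) (z : Cn n) : ℝ :=
  Real.sqrt (∑ j, ∑ k,
    (‖partialZ j (partialZ k f) z‖ ^ 2 + ‖partialZbar j (partialZ k f) z‖ ^ 2
      + ‖partialZ j (partialZbar k f) z‖ ^ 2 + ‖partialZbar j (partialZbar k f) z‖ ^ 2))

/-- The normalized Lebesgue surface measure on the unit sphere `∂𝔹ⁿ`. -/
def sphereMeasure (n : ℕ) : Measure (Metric.sphere (0 : Cn n) 1) :=
  ((volume : Measure (Cn n)).toSphere univ)⁻¹ • (volume : Measure (Cn n)).toSphere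

/-- The integral mean `M_p(r, g) = (∫_{∂𝔹ⁿ} |g(rζ)|^p dσ(ζ))^{1/p}`. -/
def integralMean {n : ℕ} {E : Type*} [NormedAddCommGroup E] (p r : ℝ) (g : Cn n → E) : ℝ :=
  (∫ ζ : Metric.sphere (0 : Cn n) 1, ‖g (r • (ζ : Cn n))‖ ^ p ∂(sphereMeasure n)) ^ (1 / p)

/-- Membership of `f` in the generalized Hardy space `H_g^p(𝔹ⁿ)`, for `0 < p < ∞`: `f` is measurable
on `𝔹ⁿ`, the integral means `M_p(r, f)` exist for `0 < r < 1`, and their supremum is finite. -/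
structure MemGenHardy {n : ℕ} (p : ℝ) (f : Cn n → ℂ) : Prop where
  measurable : Measurable (fun z : unitBall n => f z)
  integrable : ∀ r ∈ Ioo (0 : ℝ) 1,
    Integrable (fun ζ : Metric.sphere (0 : Cn n) 1 => ‖f (r • (ζ : Cn n))‖ ^ p) (sphereMeasure n)
  bddAbove : BddAbove ((fun r : ℝ => integralMean p r f) '' Ioo (0 : ℝ) 1)

/-- A majorant: a continuous increasing function `ω : [0, ∞) → [0, ∞)` with `ω(0) = 0` such that
`ω(t)/t` is non-increasing for `t > 0`. (Values at negative arguments are irrelevant.) -/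
structure IsMajorant (ω : ℝ → ℝ) : Prop where
  nonneg : ∀ t, 0 ≤ t → 0 ≤ ω t
  continuousOn : ContinuousOn ω (Ici 0)
  monotoneOn : MonotoneOn ω (Ici 0)
  map_zero : ω 0 = 0
  antitoneOn_div : AntitoneOn (fun t => ω t / t) (Ioi 0)

end

/-! Suppose first that the gradient `w` of `f` is smooth. The equation is linear with constant
coefficients, so `w` satisfies it too, in the form `Δw = Lw` with `0 ≤ ⟨w, Lw⟩ ≤ c|w|²` and `c = η +
τ`. Hence `V = |w|^p` is subharmonic and `ΔV ≤ p(p-1)|w|^(p-2)|∇w|² + pcV`. Let `m` be the spherical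
mean of `V`, and `K(s)` the `2/p`-th power of the mean of `|∇w|^p` over the sphere of radius `s`.
Hölder's inequality bounds the mean of `ΔV` by `p(p-1) m^(1-2/p) K + pcm`. Subharmonicity makes `m`
increasing, so `m(s)` can be replaced by `m(r)`. The divergence theorem then gives, in real
dimension `N = 2n`, `m(r) ≤ V(0) + p(p-1) m(r)^(1-2/p) ∫₀ʳ (r-s)K(s) ds + pc m(r) r²/(2N)`. Dividing
by `m(r)^(1-2/p)` leaves a linear inequality for `m(r)^(2/p)`, and `η + τ < 4n/p` lets the last term
be absorbed. This is `sphMean_regPow_le`, resting on `pow_mul_radMean_eq`, `lap_regPow_le` and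
`sphMean_growth`.

Two regularisations make this rigorous. Since `f` is only `C²`, its gradient need not have second
derivatives: it is replaced by the vector of difference quotients, which is `C²` and satisfies the
same equation. Powers of the norm may be singular at zeros: `|w|^p` is replaced by `(δ +
|w|²)^(p/2)`. Letting step and `δ` tend to `0` together gives `sphMean_gradSq_le`.

The majorant enters through `ω(x) ≤ ω(1)x` for `x ≥ 1`, which gives `(r-s) ω(1/(1-s))² ≤ ω(1)
ω(1/(1-s))`. The same inequality bounds the mean of the gradient by a multiple of `(1-r)^(-1/2)`,
which is integrable on `(0,1)`; integrating the radial derivative of the mean of `f` yields the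
Hardy space claim. -/

open Metric Filter Topology

/-! ### Spherical means and polar coordinates. -/

section SphericalMeans

variable {E : Type*} [NormedAddCommGroup E] [InnerProductSpace ℝ E]
  [MeasurableSpace E]

/-- The mean of `g (t • ζ)` over `ζ` in the unit sphere, with respect to a measure `ν`. -/
noncomputable def sphMean (ν : Measure (sphere (0 : E) 1)) (g : E → ℝ) (t : ℝ) : ℝ :=
  ∫ ζ : sphere (0 : E) 1, g (t • (ζ : E)) ∂ν

/-- The spherical mean of the radial derivative of `u`. -/
noncomputable def radMean (ν : Measure (sphere (0 : E) 1)) (u : E → ℝ) (t : ℝ) : ℝ :=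
  ∫ ζ : sphere (0 : E) 1, fderiv ℝ u (t • (ζ : E)) ζ ∂ν

lemma sphMean_nonneg {ν : Measure (sphere (0 : E) 1)} {f : E → ℝ}
    (h : ∀ x, 0 ≤ f x) (s : ℝ) : 0 ≤ sphMean ν f s :=
  integral_nonneg fun _ => h _

lemma sphMean_zero {ν : Measure (sphere (0 : E) 1)} [IsProbabilityMeasure ν] (f : E → ℝ) :
    sphMean ν f 0 = f 0 := by
  simp [sphMean]

variable [FiniteDimensional ℝ E] [BorelSpace E]

lemma continuous_integral_sphere (ν : Measure (sphere (0 : E) 1)) [IsFiniteMeasure ν]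
    {F : ℝ → sphere (0 : E) 1 → ℝ} (hF : Continuous (Function.uncurry F)) :
    Continuous (fun t => ∫ ζ, F t ζ ∂ν) := by
  simpa using continuous_parametric_integral_of_continuous (μ := ν) hF isCompact_univ

lemma continuous_sphMean (ν : Measure (sphere (0 : E) 1)) [IsFiniteMeasure ν] {g : E → ℝ}
    (hg : Continuous g) : Continuous (sphMean ν g) := by
  apply continuous_integral_sphere
  fun_prop

lemma continuous_radMean (ν : Measure (sphere (0 : E) 1)) [IsFiniteMeasure ν] {u : E → ℝ}
    (hu : ContDiff ℝ 1 u) : Continuous (radMean ν u) := by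
  apply continuous_integral_sphere
  have h1 := hu.continuous_fderiv one_ne_zero
  exact (h1.comp (by fun_prop : Continuous fun q : ℝ × sphere (0 : E) 1 => q.1 • (q.2 : E))).clm_apply
    (by fun_prop)

lemma integrable_sphere_of_continuous (ν : Measure (sphere (0 : E) 1)) [IsFiniteMeasure ν]
    {F : sphere (0 : E) 1 → ℝ} (hF : Continuous F) : Integrable F ν :=
  hF.integrable_of_hasCompactSupport (HasCompactSupport.of_compactSpace F)

lemma integrable_sphere_smul (ν : Measure (sphere (0 : E) 1)) [IsFiniteMeasure ν] {g : E → ℝ}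
    (hg : Continuous g) (t : ℝ) : Integrable (fun ζ : sphere (0 : E) 1 => g (t • (ζ : E))) ν :=
  integrable_sphere_of_continuous ν (by fun_prop)

lemma hasDerivAt_sphMean (ν : Measure (sphere (0 : E) 1)) [IsFiniteMeasure ν] {u : E → ℝ}
    (hu : ContDiff ℝ 1 u) (t : ℝ) : HasDerivAt (sphMean ν u) (radMean ν u t) t := by
  have h1 := hu.continuous_fderiv one_ne_zero
  have hc : Continuous (fun q : ℝ × sphere (0 : E) 1 => fderiv ℝ u (q.1 • (q.2 : E)) q.2) :=
    (h1.comp (by fun_prop)).clm_apply (by fun_prop)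
  obtain ⟨C, hC⟩ := ((isCompact_closedBall t 1).prod
    (isCompact_univ (X := sphere (0 : E) 1))).exists_bound_of_continuousOn hc.continuousOn
  refine (hasDerivAt_integral_of_dominated_loc_of_deriv_le (bound := fun _ => C)
    (F := fun s (ζ : sphere (0 : E) 1) => u (s • (ζ : E)))
    (F' := fun s (ζ : sphere (0 : E) 1) => fderiv ℝ u (s • (ζ : E)) ζ)
    (closedBall_mem_nhds t one_pos) ?_ ?_ ?_ ?_ (integrable_const C) ?_).2
  · exact .of_forall fun s => (integrable_sphere_smul ν hu.continuous s).aestronglyMeasurable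
  · exact integrable_sphere_smul ν hu.continuous t
  · exact (integrable_sphere_of_continuous ν
      (hc.comp (by fun_prop : Continuous fun ζ => (t, ζ)))).aestronglyMeasurable
  · exact .of_forall fun ζ s hs => hC (s, ζ) ⟨hs, mem_univ _⟩
  · refine .of_forall fun ζ s _ => ?_
    have h2 := (hu.differentiable one_ne_zero (s • (ζ : E))).hasFDerivAt
    have h3 : HasDerivAt (fun s : ℝ => s • (ζ : E)) ((1 : ℝ) • (ζ : E)) s :=
      (hasDerivAt_id s).smul_const _
    simpa [Function.comp_def] using h2.comp_hasDerivAt s h3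

lemma sphMean_le_sphMean {ν : Measure (sphere (0 : E) 1)} [IsFiniteMeasure ν] {f g : E → ℝ}
    (hf : Continuous f) (hg : Continuous g) {s : ℝ} (hs : 0 ≤ s)
    (h : ∀ x, ‖x‖ = s → f x ≤ g x) : sphMean ν f s ≤ sphMean ν g s :=
  integral_mono (integrable_sphere_smul ν hf s) (integrable_sphere_smul ν hg s) fun ζ =>
    h _ (by simp [norm_smul, abs_of_nonneg hs])

lemma sphMean_pos {ν : Measure (sphere (0 : E) 1)} [IsProbabilityMeasure ν] {f : E → ℝ}
    (hf : Continuous f) (h : ∀ x, 0 < f x) (s : ℝ) : 0 < sphMean ν f s := by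
  refine (integral_pos_iff_support_of_nonneg (fun ζ => (h _).le)
    (integrable_sphere_smul ν hf s)).2 ?_
  have : Function.support (fun ζ : sphere (0 : E) 1 => f (s • (ζ : E))) = univ :=
    eq_univ_of_forall fun ζ => (h _).ne'
  simp [this]

variable [Nontrivial E] (μ : Measure E) [μ.IsAddHaarMeasure]

/-- The origin is a null set, and on its complement `μ` is the product of the sphere measure and the
density `s^(N-1) ds`; the rest is Fubini. -/
lemma integral_eq_integral_sphMean {g : E → ℝ} (hg : Integrable g μ) :
    ∫ x, g x ∂μ = ∫ s in Ioi (0 : ℝ), s ^ (Module.finrank ℝ E - 1) * sphMean μ.toSphere g s := by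
  have hmp := μ.measurePreserving_homeomorphUnitSphereProd
  have hemb := (homeomorphUnitSphereProd E).measurableEmbedding
  set G : sphere (0 : E) 1 × Ioi (0 : ℝ) → ℝ := fun q => g (q.2.1 • (q.1 : E)) with hG
  have hcomp : G ∘ homeomorphUnitSphereProd E = fun x : ({0}ᶜ : Set E) => g x := by
    ext x
    have : ‖(x : E)‖ ≠ 0 := norm_ne_zero_iff.2 x.2
    simp [hG, smul_smul, this]
  have hint : Integrable G (μ.toSphere.prod (.volumeIoiPow (Module.finrank ℝ E - 1))) := by
    rw [← hmp.integrable_comp_emb hemb, hcomp]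
    have := (integrableOn_iff_comap_subtypeVal (f := g) (μ := μ)
      (measurableSet_singleton (0 : E)).compl).1 hg.integrableOn
    exact this
  calc
    ∫ x, g x ∂μ = ∫ x : ({(0)}ᶜ : Set E), g x ∂(μ.comap (↑)) := by
      rw [integral_subtype_comap (measurableSet_singleton _).compl g, restrict_compl_singleton]
    _ = ∫ q, G q ∂(μ.toSphere.prod (.volumeIoiPow (Module.finrank ℝ E - 1))) := by
      rw [← hmp.integral_comp hemb]
      exact integral_congr_ae (.of_forall fun x => (congrFun hcomp x).symm)
    _ = ∫ s : Ioi (0 : ℝ), sphMean μ.toSphere g s ∂(.volumeIoiPow (Module.finrank ℝ E - 1)) :=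
      integral_prod_symm G hint
    _ = _ := by
      simp only [Measure.volumeIoiPow, ENNReal.ofReal]
      rw [integral_withDensity_eq_integral_smul,
        integral_subtype_comap measurableSet_Ioi fun a ↦
          Real.toNNReal (a ^ (Module.finrank ℝ E - 1)) • sphMean μ.toSphere g a]
      · refine setIntegral_congr_fun measurableSet_Ioi fun x hx ↦ ?_
        simp only [NNReal.smul_def]
        rw [Real.coe_toNNReal _ (pow_nonneg (le_of_lt hx) _), smul_eq_mul]
      · exact (measurable_subtype_coe.pow_const _).real_toNNReal

end SphericalMeans

/-! ### The divergence theorem on balls, through radial test functions. -/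

section Green

variable {E : Type*} [NormedAddCommGroup E] [InnerProductSpace ℝ E] {ι : Type*} [Fintype ι]

/-- The sum of the pure second derivatives of `u` along the vectors of an orthonormal basis. -/
noncomputable def lap {F : Type*} [NormedAddCommGroup F] [NormedSpace ℝ F]
    (b : OrthonormalBasis ι ℝ E) (u : E → F) (x : E) : F :=
  ∑ i, fderiv ℝ (fun y => fderiv ℝ u y (b i)) x (b i)

variable {F : Type*} [NormedAddCommGroup F] [NormedSpace ℝ F]

lemma contDiff_fderiv_const {u : E → F} (hu : ContDiff ℝ 2 u) (v : E) :
    ContDiff ℝ 1 (fun y => fderiv ℝ u y v) :=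
  (hu.fderiv_right (m := 1) (by norm_num)).clm_apply contDiff_const

lemma continuous_lap (b : OrthonormalBasis ι ℝ E) {u : E → F} (hu : ContDiff ℝ 2 u) :
    Continuous (lap b u) := by
  unfold lap
  refine continuous_finsetSum _ fun i _ => ?_
  exact ((contDiff_fderiv_const hu (b i)).continuous_fderiv one_ne_zero).clm_apply continuous_const

lemma sum_inner_mul_fderiv (b : OrthonormalBasis ι ℝ E) (u : E → ℝ) (x y : E) :
    ∑ i, inner ℝ y (b i) * fderiv ℝ u x (b i) = fderiv ℝ u x y := by
  conv_rhs => rw [← b.sum_repr' y]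
  simp [real_inner_comm]

/-- Constancy of `ψ` up to `a` removes the singularity of the norm at the origin. -/
lemma contDiff_comp_norm {ψ : ℝ → ℝ} (hψ : ContDiff ℝ 1 ψ) {a : ℝ} (ha : 0 < a)
    (hψa : ∀ s ≤ a, ψ s = ψ 0) : ContDiff ℝ 1 (fun x : E => ψ ‖x‖) := by
  rw [contDiff_iff_contDiffAt]
  intro x
  by_cases hx : x = 0
  · have : (fun x : E => ψ ‖x‖) =ᶠ[𝓝 x] fun _ => ψ 0 := by
      filter_upwards [ball_mem_nhds x ha] with y hy
      refine hψa _ ?_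
      rw [hx, mem_ball_zero_iff] at hy
      exact hy.le
    exact contDiffAt_const.congr_of_eventuallyEq this
  · exact hψ.contDiffAt.comp x (contDiffAt_norm ℝ hx)

lemma fderiv_comp_norm {ψ : ℝ → ℝ} (hψ : ContDiff ℝ 1 ψ) {s : ℝ} (hs : 0 < s)
    (ζ : sphere (0 : E) 1) (v : E) :
    fderiv ℝ (fun x : E => ψ ‖x‖) (s • (ζ : E)) v = deriv ψ s * inner ℝ (ζ : E) v := by
  have hζ : ‖(ζ : E)‖ = 1 := by simp
  have hn : ‖s • (ζ : E)‖ = s := by rw [norm_smul, hζ, Real.norm_of_nonneg hs.le, mul_one]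
  have hx : s • (ζ : E) ≠ 0 := by rw [← norm_ne_zero_iff, hn]; exact hs.ne'
  have h1 : HasFDerivAt (fun x : E => ‖x‖) (innerSL ℝ (ζ : E)) (s • (ζ : E)) := by
    have h := (hasStrictFDerivAt_norm_sq (s • (ζ : E))).hasFDerivAt.sqrt
      (by rw [hn]; positivity)
    simp only [Real.sqrt_sq (norm_nonneg _)] at h
    convert h using 1
    ext w
    simp [hn]
    field_simp
  have h2 : HasDerivAt ψ (deriv ψ s) ‖s • (ζ : E)‖ := by
    rw [hn]; exact (hψ.differentiable one_ne_zero s).hasDerivAt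
  have h3 : HasFDerivAt (fun x : E => ψ ‖x‖) _ (s • (ζ : E)) := h2.comp_hasFDerivAt _ h1
  rw [h3.fderiv]
  simp

variable [FiniteDimensional ℝ E] [MeasurableSpace E] [BorelSpace E]

lemma integral_mul_lap (μ : Measure E) [μ.IsAddHaarMeasure] (b : OrthonormalBasis ι ℝ E)
    {φ u : E → ℝ} (hφ : ContDiff ℝ 1 φ)
    (hφc : HasCompactSupport φ) (hu : ContDiff ℝ 2 u) :
    ∫ x, φ x * lap b u x ∂μ = - ∫ x, ∑ i, fderiv ℝ φ x (b i) * fderiv ℝ u x (b i) ∂μ := by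
  have hφ' : ∀ v, Continuous fun x => fderiv ℝ φ x v := fun v =>
    (hφ.continuous_fderiv one_ne_zero).clm_apply continuous_const
  have hφc' : ∀ v, HasCompactSupport fun x => fderiv ℝ φ x v := fun v => hφc.fderiv_apply ℝ v
  have hu' : ∀ v, ContDiff ℝ 1 fun x => fderiv ℝ u x v := contDiff_fderiv_const hu
  have hu'' : ∀ v, Continuous fun x => fderiv ℝ (fun y => fderiv ℝ u y v) x v := fun v =>
    ((hu' v).continuous_fderiv one_ne_zero).clm_apply continuous_const
  have h1 : ∀ i, Integrable (fun x => fderiv ℝ φ x (b i) * fderiv ℝ u x (b i)) μ := fun i =>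
    ((hφ' _).mul (hu' _).continuous).integrable_of_hasCompactSupport (hφc' _).mul_right
  have h2 : ∀ i, Integrable (fun x => φ x * fderiv ℝ (fun y => fderiv ℝ u y (b i)) x (b i)) μ :=
    fun i => (hφ.continuous.mul (hu'' _)).integrable_of_hasCompactSupport hφc.mul_right
  simp only [lap, Finset.mul_sum]
  rw [integral_finsetSum _ fun i _ => h2 i, integral_finsetSum _ fun i _ => h1 i,
    ← Finset.sum_neg_distrib]
  refine Finset.sum_congr rfl fun i _ => ?_
  refine integral_mul_fderiv_eq_neg_fderiv_mul_of_integrable (h1 i) (h2 i) ?_ ?_ ?_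
  · exact (hφ.continuous.mul (hu' _).continuous).integrable_of_hasCompactSupport hφc.mul_right
  · exact fun x _ => hφ.differentiable one_ne_zero x
  · exact fun x _ => (hu' _).differentiable one_ne_zero x

variable [Nontrivial E] (μ : Measure E) [μ.IsAddHaarMeasure]

/-- The radial weak form of `A' = B` for the spherical means of a function and its Laplacian. -/
lemma integral_radial_test (b : OrthonormalBasis ι ℝ E)
    {u : E → ℝ} (hu : ContDiff ℝ 2 u) {ψ : ℝ → ℝ} (hψ : ContDiff ℝ 1 ψ) {a T : ℝ} (ha : 0 < a)
    (hψa : ∀ s ≤ a, ψ s = ψ 0) (hψT : ∀ s, T ≤ s → ψ s = 0) :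
    ∫ s in Ioi (0 : ℝ), ψ s * (s ^ (Module.finrank ℝ E - 1) * sphMean μ.toSphere (lap b u) s) =
      - ∫ s in Ioi (0 : ℝ), deriv ψ s *
        (s ^ (Module.finrank ℝ E - 1) * radMean μ.toSphere u s) := by
  set φ : E → ℝ := fun x => ψ ‖x‖ with hφdef
  have hφ : ContDiff ℝ 1 φ := contDiff_comp_norm hψ ha hψa
  have hφc : HasCompactSupport φ := by
    refine HasCompactSupport.intro (isCompact_closedBall (0 : E) T) fun x hx => ?_
    rw [mem_closedBall_zero_iff, not_le] at hx
    exact hψT _ hx.le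
  have hφ' : ∀ v, Continuous fun x => fderiv ℝ φ x v := fun v =>
    (hφ.continuous_fderiv one_ne_zero).clm_apply continuous_const
  have key := integral_mul_lap μ b hφ hφc hu
  rw [integral_eq_integral_sphMean μ, integral_eq_integral_sphMean μ] at key
  · convert key using 1
    · refine setIntegral_congr_fun measurableSet_Ioi fun s hs => ?_
      have hs' : (0 : ℝ) < s := hs
      simp only [sphMean]
      rw [← integral_const_mul, ← integral_const_mul, ← integral_const_mul]
      refine integral_congr_ae (.of_forall fun ζ => ?_)
      simp [hφdef, norm_smul, abs_of_pos hs']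
      ring
    · congr 1
      refine setIntegral_congr_fun measurableSet_Ioi fun s hs => ?_
      have hs' : (0 : ℝ) < s := hs
      simp only [sphMean, radMean]
      rw [← integral_const_mul, ← integral_const_mul, ← integral_const_mul]
      refine integral_congr_ae (.of_forall fun ζ => ?_)
      simp only [hφdef, fderiv_comp_norm hψ hs']
      rw [← sum_inner_mul_fderiv b u _ (ζ : E), Finset.mul_sum, Finset.mul_sum, Finset.mul_sum]
      refine Finset.sum_congr rfl fun i _ => ?_
      ring
  · refine Continuous.integrable_of_hasCompactSupport ?_ ?_
    · exact continuous_finsetSum _ fun i _ =>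
        (hφ' _).mul (contDiff_fderiv_const hu _).continuous
    · refine HasCompactSupport.intro hφc fun x hx => ?_
      refine Finset.sum_eq_zero fun i _ => ?_
      have : fderiv ℝ φ x = 0 := image_eq_zero_of_notMem_tsupport
        (fun h => hx (tsupport_fderiv_subset ℝ h))
      simp [this]
  · exact (hφ.continuous.mul (continuous_lap b hu)).integrable_of_hasCompactSupport hφc.mul_right

/-- The divergence theorem for a gradient field on a ball, in terms of spherical means. -/
lemma pow_mul_radMean_eq (b : OrthonormalBasis ι ℝ E) {u : E → ℝ} (hu : ContDiff ℝ 2 u)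
    {t : ℝ} (ht : 0 < t) :
    t ^ (Module.finrank ℝ E - 1) * radMean μ.toSphere u t =
      ∫ s in (0 : ℝ)..t, s ^ (Module.finrank ℝ E - 1) * sphMean μ.toSphere (lap b u) s := by
  set A : ℝ → ℝ := fun s => s ^ (Module.finrank ℝ E - 1) * radMean μ.toSphere u s
  set B : ℝ → ℝ := fun s => s ^ (Module.finrank ℝ E - 1) * sphMean μ.toSphere (lap b u) s
  set I : ℝ → ℝ := fun t => ∫ s in (0 : ℝ)..t, B s
  have hA : Continuous A := (continuous_pow _).mul (continuous_radMean _ (hu.of_le one_le_two))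
  have hB : Continuous B := (continuous_pow _).mul (continuous_sphMean _ (continuous_lap b hu))
  have hI : ∀ t, HasDerivAt I (B t) t := fun t => hB.integral_hasStrictDerivAt 0 t |>.hasDerivAt
  have hIc : Continuous I := continuous_iff_continuousAt.2 fun t => (hI t).continuousAt
  have hD : Continuous (fun s => A s - I s) := hA.sub hIc
  -- `A` is only known to be continuous, so `A' = B` is used weakly: `A - I` is tested against every
  -- smooth `θ` with compact support in `(0, ∞)`.
  have hae : ∀ᵐ s, s ∈ Ioi (0 : ℝ) → A s - I s = 0 := by
    refine isOpen_Ioi.ae_eq_zero_of_integral_contDiff_smul_eq_zero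
      (hD.locallyIntegrable.locallyIntegrableOn _) fun θ hθ hθc hθs => ?_
    obtain ⟨a, ha, haθ⟩ : ∃ a > 0, ∀ s ≤ a, θ s = 0 := by
      rcases (tsupport θ).eq_empty_or_nonempty with h | h
      · exact ⟨1, one_pos, fun s _ => image_eq_zero_of_notMem_tsupport (by simp [h])⟩
      · obtain ⟨a, ha⟩ := hθc.isCompact.exists_isLeast h
        have ha0 : 0 < a := hθs ha.1
        refine ⟨a / 2, half_pos ha0, fun s hs => image_eq_zero_of_notMem_tsupport fun h' => ?_⟩
        have := ha.2 h'
        linarith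
    obtain ⟨T₀, hT₀⟩ := hθc.isCompact.bddAbove
    set T := max T₀ 0 + 1
    have hT : 0 < T := by positivity
    have hTθ : ∀ s, T ≤ s → θ s = 0 := fun s hs => image_eq_zero_of_notMem_tsupport fun h' => by
      have := hT₀ h'
      have := le_max_left T₀ 0
      linarith
    -- The primitive of `-θ` vanishing beyond the support of `θ`; it is constant near `0` because
    -- `θ` vanishes there, so it is an admissible radial profile.
    set ψ : ℝ → ℝ := fun s => - ∫ y in T..s, θ y
    have hψ' : ∀ s, HasDerivAt ψ (-θ s) s := fun s =>
      (hθ.continuous.integral_hasStrictDerivAt T s).hasDerivAt.neg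
    have hdψ : deriv ψ = fun s => -θ s := funext fun s => (hψ' s).deriv
    have hψ : ContDiff ℝ 1 ψ := by
      rw [contDiff_one_iff_deriv]
      exact ⟨fun s => (hψ' s).differentiableAt, by rw [hdψ]; exact hθ.continuous.neg⟩
    have hψT : ∀ s, T ≤ s → ψ s = 0 := fun s hs => by
      have : ∫ y in T..s, θ y = ∫ y in T..s, (0 : ℝ) :=
        intervalIntegral.integral_congr fun y hy => by
          rw [uIcc_of_le hs] at hy; exact hTθ y hy.1
      simp [ψ, this]
    have hψa : ∀ s ≤ a, ψ s = ψ 0 := fun s hs => by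
      have h0 : ∫ y in (0 : ℝ)..s, θ y = ∫ y in (0 : ℝ)..s, (0 : ℝ) :=
        intervalIntegral.integral_congr fun y hy => by
          have := hy.2
          exact haθ y (this.trans (max_le ha.le hs))
      have h1 := intervalIntegral.integral_add_adjacent_intervals
        (hθ.continuous.intervalIntegrable (μ := volume) T 0)
        (hθ.continuous.intervalIntegrable (μ := volume) 0 s)
      simp only [ψ]
      rw [← h1, h0]
      simp
    have htest := integral_radial_test μ b hu hψ ha hψa hψT
    have hcut : ∀ h : ℝ → ℝ, (∀ s, T ≤ s → h s = 0) →
        ∫ s in Ioi (0 : ℝ), h s = ∫ s in (0 : ℝ)..T, h s := fun h hh => by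
      rw [intervalIntegral.integral_of_le hT.le]
      refine (setIntegral_eq_of_subset_of_forall_sdiff_eq_zero measurableSet_Ioi
        Ioc_subset_Ioi_self fun s hs => hh s ?_)
      by_contra! h'
      exact hs.2 ⟨hs.1, h'.le⟩
    rw [hcut _ fun s hs => by rw [hψT s hs, zero_mul],
      hcut _ fun s hs => by rw [hdψ]; simp [hTθ s hs]] at htest
    -- Both boundary terms vanish, as `ψ T = 0` and `I 0 = 0`. This turns `∫ ψB` into `∫ θI`, while
    -- the radial test identity turns it into `∫ θA`.
    have hparts := intervalIntegral.integral_mul_deriv_eq_deriv_mul (a := 0) (b := T)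
      (u := ψ) (v := I) (u' := fun s => -θ s) (v' := B) (fun s _ => hψ' s) (fun s _ => hI s)
      (hθ.continuous.neg.intervalIntegrable _ _) (hB.intervalIntegrable _ _)
    rw [htest, hψT T le_rfl, hdψ] at hparts
    have hI0 : I 0 = 0 := by simp [I]
    rw [hI0] at hparts
    have hsub : ∫ s, θ s • (A s - I s) = ∫ s in (0 : ℝ)..T, θ s * A s - θ s * I s := by
      rw [← hcut _ fun s hs => by simp [hTθ s hs], ← integral_indicator measurableSet_Ioi]
      refine integral_congr_ae (.of_forall fun s => ?_)
      by_cases hs : s ∈ Ioi (0 : ℝ)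
      · simp [hs, mul_sub]
      · have : θ s = 0 := haθ s ((not_lt.1 hs).trans ha.le)
        simp [hs, this]
    have hsplit := intervalIntegral.integral_sub (f := fun s => θ s * A s)
      (g := fun s => θ s * I s) ((hθ.continuous.mul hA).intervalIntegrable (μ := volume) 0 T)
      ((hθ.continuous.mul hIc).intervalIntegrable _ _)
    rw [hsub, hsplit]
    simp only [neg_mul, intervalIntegral.integral_neg, zero_mul, mul_zero, sub_zero, zero_sub,
      neg_neg] at hparts
    rw [sub_eq_zero]
    exact hparts
  have hzero : EqOn (fun s => A s - I s) (fun _ => 0) (Ioi 0) :=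
    Measure.eqOn_open_of_ae_eq ((ae_restrict_iff' measurableSet_Ioi).2 hae) isOpen_Ioi
      hD.continuousOn continuousOn_const
  exact sub_eq_zero.1 (hzero ht)

end Green

/-! ### Hölder's inequality and regularised powers of a norm. -/

/-- Hölder's inequality in the form `∫ F^(s-1) G ≤ ‖F‖_s^(s-1) ‖G‖_s` on a compact space. -/
lemma integral_rpow_sub_one_mul_le {X : Type*} [TopologicalSpace X] [CompactSpace X]
    [MeasurableSpace X] [BorelSpace X] (ν : Measure X) [IsFiniteMeasure ν]
    {F G : X → ℝ} (hF : Continuous F) (hG : Continuous G) (hF0 : ∀ x, 0 ≤ F x)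
    (hG0 : ∀ x, 0 ≤ G x) {s : ℝ} (hs : 1 ≤ s) :
    ∫ x, F x ^ (s - 1) * G x ∂ν ≤
      (∫ x, F x ^ s ∂ν) ^ (1 - 1 / s) * (∫ x, G x ^ s ∂ν) ^ (1 / s) := by
  -- At `s = 1` the conjugate exponent `s / (s - 1)` degenerates. This case is needed: it is `p = 2`
  -- when `s = p / 2`.
  rcases hs.eq_or_lt with rfl | hs
  · simp
  have hmem : ∀ (f : X → ℝ), Continuous f → ∀ q, MemLp f q ν := fun f hf q =>
    hf.memLp_of_hasCompactSupport (HasCompactSupport.of_compactSpace f)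
  have hs0 : 0 < s - 1 := by linarith
  have hconj : (s / (s - 1)).HolderConjugate s := by
    have := Real.HolderConjugate.conjExponent hs
    exact this.symm
  have hcF : Continuous fun x => F x ^ (s - 1) := hF.rpow_const fun x => Or.inr hs0.le
  have := integral_mul_le_Lp_mul_Lq_of_nonneg (μ := ν) hconj (f := fun x => F x ^ (s - 1))
    (g := G) (.of_forall fun x => Real.rpow_nonneg (hF0 x) _) (.of_forall hG0)
    (hmem _ hcF _) (hmem _ hG _)
  convert this using 3
  · refine integral_congr_ae (.of_forall fun x => ?_)
    simp only
    rw [← Real.rpow_mul (hF0 x)]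
    congr 1
    field_simp
  · field_simp

lemma regBase_pos {E H : Type*} [NormedAddCommGroup H] {δ : ℝ} (hδ : 0 < δ) (w : E → H) (x : E) :
    0 < δ + ‖w x‖ ^ 2 := by
  positivity

/-- A smooth substitute for `‖w‖ ^ p`. -/
noncomputable def regPow {E H : Type*} [NormedAddCommGroup H] (δ p : ℝ) (w : E → H) (x : E) : ℝ :=
  (δ + ‖w x‖ ^ 2) ^ (p / 2)

lemma regPow_pos {E H : Type*} [NormedAddCommGroup H] {δ : ℝ} (hδ : 0 < δ) (p : ℝ) (w : E → H) (x : E) :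
    0 < regPow δ p w x :=
  Real.rpow_pos_of_pos (regBase_pos hδ w x) _

/-! ### The Laplacian of a regularised power. -/

section PowerLaplacian

variable {E : Type*} [NormedAddCommGroup E] [InnerProductSpace ℝ E] {ι : Type*} [Fintype ι]
  {H : Type*} [NormedAddCommGroup H] [InnerProductSpace ℝ H]

/-- The squared Hilbert–Schmidt norm of the derivative of `w`. -/
noncomputable def gradSq {F : Type*} [NormedAddCommGroup F] [NormedSpace ℝ F]
    (b : OrthonormalBasis ι ℝ E) (w : E → F) (x : E) : ℝ :=
  ∑ i, ‖fderiv ℝ w x (b i)‖ ^ 2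

lemma gradSq_nonneg (b : OrthonormalBasis ι ℝ E) (w : E → H) (x : E) : 0 ≤ gradSq b w x :=
  Finset.sum_nonneg fun _ _ => sq_nonneg _

lemma continuous_gradSq (b : OrthonormalBasis ι ℝ E) {w : E → H} (hw : ContDiff ℝ 1 w) :
    Continuous (gradSq b w) :=
  continuous_finsetSum _ fun _ _ =>
    (((hw.continuous_fderiv one_ne_zero).clm_apply continuous_const).norm.pow 2)

lemma contDiff_regPow {δ : ℝ} (hδ : 0 < δ) (p : ℝ) {w : E → H} {n : WithTop ℕ∞}
    (hw : ContDiff ℝ n w) : ContDiff ℝ n (regPow δ p w) :=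
  (contDiff_const.add (hw.norm_sq ℝ)).rpow_const_of_ne fun x => (regBase_pos hδ w x).ne'

lemma hasFDerivAt_regBase_rpow {δ : ℝ} (hδ : 0 < δ) (q : ℝ) {w : E → H} (hw : ContDiff ℝ 1 w)
    (x v : E) :
    DifferentiableAt ℝ (fun y => (δ + ‖w y‖ ^ 2) ^ q) x ∧
    fderiv ℝ (fun y => (δ + ‖w y‖ ^ 2) ^ q) x v =
      2 * q * (δ + ‖w x‖ ^ 2) ^ (q - 1) * inner ℝ (w x) (fderiv ℝ w x v) := by
  have h1 := ((hw.differentiable one_ne_zero x).hasFDerivAt.norm_sq.const_add δ).rpow_const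
    (p := q) (Or.inl (regBase_pos hδ w x).ne')
  refine ⟨h1.differentiableAt, ?_⟩
  rw [h1.fderiv]
  simp
  ring

lemma fderiv_regPow {δ : ℝ} (hδ : 0 < δ) (p : ℝ) {w : E → H} (hw : ContDiff ℝ 1 w) (x v : E) :
    fderiv ℝ (regPow δ p w) x v =
      p * (δ + ‖w x‖ ^ 2) ^ (p / 2 - 1) * inner ℝ (w x) (fderiv ℝ w x v) := by
  have := (hasFDerivAt_regBase_rpow hδ (p / 2) hw x v).2
  rw [mul_div_cancel₀ _ (two_ne_zero' ℝ)] at this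
  exact this

lemma lap_regPow (b : OrthonormalBasis ι ℝ E) {δ : ℝ} (hδ : 0 < δ) (p : ℝ) {w : E → H}
    (hw : ContDiff ℝ 2 w) (x : E) :
    lap b (regPow δ p w) x =
      p * (p - 2) * (δ + ‖w x‖ ^ 2) ^ (p / 2 - 2) *
          ∑ i, inner ℝ (w x) (fderiv ℝ w x (b i)) ^ 2 +
        p * (δ + ‖w x‖ ^ 2) ^ (p / 2 - 1) * (gradSq b w x + inner ℝ (w x) (lap b w x)) := by
  have hw1 : ContDiff ℝ 1 w := hw.of_le one_le_two
  have key : ∀ v, fderiv ℝ (fun y => fderiv ℝ (regPow δ p w) y v) x v =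
      p * (p - 2) * (δ + ‖w x‖ ^ 2) ^ (p / 2 - 2) * inner ℝ (w x) (fderiv ℝ w x v) ^ 2 +
        p * (δ + ‖w x‖ ^ 2) ^ (p / 2 - 1) * (‖fderiv ℝ w x v‖ ^ 2 +
          inner ℝ (w x) (fderiv ℝ (fun y => fderiv ℝ w y v) x v)) := by
    intro v
    simp only [fderiv_regPow hδ p hw1]
    obtain ⟨h1, h2⟩ := hasFDerivAt_regBase_rpow hδ (p / 2 - 1) hw1 x v
    have h3 : DifferentiableAt ℝ w x := hw1.differentiable one_ne_zero x
    have h4 : DifferentiableAt ℝ (fun y => fderiv ℝ w y v) x :=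
      (contDiff_fderiv_const hw v).differentiable one_ne_zero x
    rw [fderiv_fun_mul (h1.const_mul p) (h3.inner ℝ h4), fderiv_const_mul h1]
    simp only [add_apply, smul_apply, fderiv_inner_apply ℝ h3 h4, h2, smul_eq_mul,
      real_inner_self_eq_norm_sq]
    rw [show p / 2 - 2 = p / 2 - 1 - 1 by ring]
    ring
  simp only [lap, key, gradSq, Finset.sum_add_distrib, inner_sum, ← Finset.mul_sum]

lemma lap_regPow_nonneg (b : OrthonormalBasis ι ℝ E) {δ : ℝ} (hδ : 0 < δ) {p : ℝ} (hp : 2 ≤ p)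
    {w : E → H} (hw : ContDiff ℝ 2 w) {x : E} (hx : 0 ≤ inner ℝ (w x) (lap b w x)) :
    0 ≤ lap b (regPow δ p w) x := by
  rw [lap_regPow b hδ p hw]
  have h0 := regBase_pos hδ w x
  have h1 : 0 ≤ ∑ i, inner ℝ (w x) (fderiv ℝ w x (b i)) ^ 2 :=
    Finset.sum_nonneg fun _ _ => sq_nonneg _
  have h2 := gradSq_nonneg b w x
  have h3 : 0 ≤ p - 2 := by linarith
  positivity

/-- By Cauchy–Schwarz `⟨w, ∂ᵢw⟩² ≤ (δ + |w|²)|∂ᵢw|²`, so the two gradient terms of `lap_regPow`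
merge with coefficient `p(p-2) + p = p(p-1)`. -/
lemma lap_regPow_le (b : OrthonormalBasis ι ℝ E) {δ : ℝ} (hδ : 0 < δ) {p c : ℝ} (hp : 2 ≤ p)
    (hc : 0 ≤ c) {w : E → H} (hw : ContDiff ℝ 2 w) {x : E}
    (hx : inner ℝ (w x) (lap b w x) ≤ c * ‖w x‖ ^ 2) :
    lap b (regPow δ p w) x ≤
      p * (p - 1) * ((δ + ‖w x‖ ^ 2) ^ (p / 2 - 1) * gradSq b w x) + p * c * regPow δ p w x := by
  rw [lap_regPow b hδ p hw]
  set v := δ + ‖w x‖ ^ 2 with hv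
  have h0 : 0 < v := regBase_pos hδ w x
  have hp2 : 0 ≤ p - 2 := by linarith
  have e1 : v ^ (p / 2 - 1) = v ^ (p / 2 - 2) * v := by
    rw [← Real.rpow_add_one h0.ne']; congr 1; ring
  have e2 : regPow δ p w x = v ^ (p / 2 - 1) * v := by
    rw [regPow, ← hv, ← Real.rpow_add_one h0.ne']; congr 1; ring
  have h1 : ∑ i, inner ℝ (w x) (fderiv ℝ w x (b i)) ^ 2 ≤ v * gradSq b w x := by
    rw [gradSq, Finset.mul_sum]
    refine Finset.sum_le_sum fun i _ => ?_
    have := abs_real_inner_le_norm (w x) (fderiv ℝ w x (b i))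
    calc inner ℝ (w x) (fderiv ℝ w x (b i)) ^ 2
        ≤ (‖w x‖ * ‖fderiv ℝ w x (b i)‖) ^ 2 := sq_le_sq' (abs_le.1 this).1 (abs_le.1 this).2
      _ = ‖w x‖ ^ 2 * ‖fderiv ℝ w x (b i)‖ ^ 2 := by ring
      _ ≤ v * ‖fderiv ℝ w x (b i)‖ ^ 2 := by
        gcongr
        linarith
  have h2 : inner ℝ (w x) (lap b w x) ≤ c * v := hx.trans (by gcongr; linarith)
  calc _ ≤ p * (p - 2) * v ^ (p / 2 - 2) * (v * gradSq b w x) +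
        p * v ^ (p / 2 - 1) * (gradSq b w x + c * v) := by gcongr
    _ = _ := by rw [e2, e1]; ring

end PowerLaplacian

/-! ### The integral estimate for `C²` vector fields. -/

section RegularisedEstimate

variable {E : Type*} [NormedAddCommGroup E] [InnerProductSpace ℝ E] [FiniteDimensional ℝ E]
  [MeasurableSpace E] [BorelSpace E] [Nontrivial E] {ι : Type*} [Fintype ι]
  {H : Type*} [NormedAddCommGroup H] [InnerProductSpace ℝ H]

/-- The normalized surface measure on the unit sphere. -/
noncomputable def normSphere (μ : Measure E) : Measure (sphere (0 : E) 1) :=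
  (μ.toSphere univ)⁻¹ • μ.toSphere

variable (μ : Measure E) [μ.IsAddHaarMeasure]

instance isProbabilityMeasure_normSphere : IsProbabilityMeasure (normSphere μ) :=
  have : NeZero μ.toSphere := ⟨Measure.toSphere_ne_zero μ⟩
  inferInstanceAs (IsProbabilityMeasure ((μ.toSphere univ)⁻¹ • μ.toSphere))

lemma pow_mul_radMean_normSphere_eq (b : OrthonormalBasis ι ℝ E) {u : E → ℝ}
    (hu : ContDiff ℝ 2 u) {t : ℝ} (ht : 0 < t) :
    t ^ (Module.finrank ℝ E - 1) * radMean (normSphere μ) u t =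
      ∫ s in (0 : ℝ)..t, s ^ (Module.finrank ℝ E - 1) * sphMean (normSphere μ) (lap b u) s := by
  have h := pow_mul_radMean_eq μ b hu ht
  have h1 : ∀ s, sphMean (normSphere μ) (lap b u) s =
      ((μ.toSphere univ)⁻¹).toReal * sphMean μ.toSphere (lap b u) s := fun s => by
    simp only [sphMean, normSphere, integral_smul_measure, smul_eq_mul]
  have h2 : radMean (normSphere μ) u t =
      ((μ.toSphere univ)⁻¹).toReal * radMean μ.toSphere u t := by
    simp only [radMean, normSphere, integral_smul_measure, smul_eq_mul]
  simp only [h1, h2, mul_left_comm _ ((μ.toSphere univ)⁻¹).toReal, h,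
    intervalIntegral.integral_const_mul]

/-- A spherical mean whose Laplacian is nonnegative and bounded by `k + d` grows at most like the
solution of the corresponding radial problem. -/
lemma sphMean_growth (b : OrthonormalBasis ι ℝ E) {u : E → ℝ} (hu : ContDiff ℝ 2 u)
    {r d : ℝ} (hr : 0 < r) {k : ℝ → ℝ} (hk : Continuous k) (hk0 : ∀ s, 0 ≤ k s)
    (hle : ∀ s ∈ Icc 0 r, sphMean (normSphere μ) (lap b u) s ≤ k s + d) :
    sphMean (normSphere μ) u r ≤ u 0 + (∫ s in (0 : ℝ)..r, (r - s) * k s) +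
      d * r ^ 2 / (2 * Module.finrank ℝ E) := by
  set ν := normSphere μ
  set N := Module.finrank ℝ E with hN
  have hN0 : 0 < N := Module.finrank_pos
  have hNr : (0 : ℝ) < N := by exact_mod_cast hN0
  have hu1 : ContDiff ℝ 1 u := hu.of_le one_le_two
  have hS : Continuous (sphMean ν (lap b u)) := continuous_sphMean ν (continuous_lap b hu)
  -- The weight `s^(N-1)` is bounded by `t^(N-1)` only against `k`. Against the constant `d` it is
  -- integrated exactly, which produces the factor `1/N` behind the threshold `4n/p`.
  have hrad : ∀ t ∈ Ioc 0 r, radMean ν u t ≤ (∫ s in (0 : ℝ)..t, k s) + d * t / N := by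
    intro t ht
    have ht0 : 0 < t := ht.1
    have hpow : 0 < t ^ (N - 1) := pow_pos ht0 _
    refine le_of_mul_le_mul_left ?_ hpow
    rw [pow_mul_radMean_normSphere_eq μ b hu ht0]
    calc ∫ s in (0 : ℝ)..t, s ^ (N - 1) * sphMean ν (lap b u) s
        ≤ ∫ s in (0 : ℝ)..t, (t ^ (N - 1) * k s + d * s ^ (N - 1)) := by
          refine intervalIntegral.integral_mono_on ht0.le
            (((continuous_pow _).mul hS).intervalIntegrable _ _)
            (Continuous.intervalIntegrable (by fun_prop) _ _) fun s hs => ?_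
          have h1 := hle s ⟨hs.1, hs.2.trans ht.2⟩
          have h2 : s ^ (N - 1) ≤ t ^ (N - 1) := pow_le_pow_left₀ hs.1 hs.2 _
          have h3 : 0 ≤ s ^ (N - 1) := pow_nonneg hs.1 _
          nlinarith [mul_le_mul_of_nonneg_left h1 h3, mul_le_mul_of_nonneg_right h2 (hk0 s)]
      _ = t ^ (N - 1) * (∫ s in (0 : ℝ)..t, k s) + d * (t ^ N / N) := by
          rw [intervalIntegral.integral_add (Continuous.intervalIntegrable (by fun_prop) _ _)
            (Continuous.intervalIntegrable (by fun_prop) _ _),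
            intervalIntegral.integral_const_mul, intervalIntegral.integral_const_mul, integral_pow,
            Nat.sub_add_cancel hN0]
          congr 3
          · simp [hN0.ne']
          · rw [Nat.cast_pred hN0]; ring
      _ = t ^ (N - 1) * ((∫ s in (0 : ℝ)..t, k s) + d * t / N) := by
          rw [← Nat.sub_add_cancel hN0, pow_succ, Nat.sub_add_cancel hN0]; ring
  -- The claimed bound (without `u 0`) minus the mean, with `∫ (t-s)k` split so that `t` leaves the
  -- integrand; `hrad` says that `G' ≥ 0`.
  set G : ℝ → ℝ := fun t => (t * (∫ s in (0 : ℝ)..t, k s) - ∫ s in (0 : ℝ)..t, s * k s) +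
    d * t ^ 2 / (2 * N) - sphMean ν u t
  have hG : ∀ t, HasDerivAt G (((∫ s in (0 : ℝ)..t, k s) + d * t / N) - radMean ν u t) t := by
    intro t
    have h1 := (hk.integral_hasStrictDerivAt 0 t).hasDerivAt
    have h2 := ((continuous_id.mul hk).integral_hasStrictDerivAt 0 t).hasDerivAt
    have h3 := ((hasDerivAt_pow 2 t).const_mul d).div_const (2 * (N : ℝ))
    have h4 := ((((hasDerivAt_id t).mul h1).sub h2).add h3).sub (hasDerivAt_sphMean ν hu1 t)
    refine h4.congr_deriv ?_
    simp
    field_simp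
  have hmono : MonotoneOn G (Icc 0 r) := by
    refine monotoneOn_of_deriv_nonneg (convex_Icc 0 r)
      (fun t _ => (hG t).continuousAt.continuousWithinAt)
      (fun t _ => (hG t).differentiableAt.differentiableWithinAt) fun t ht => ?_
    rw [interior_Icc] at ht
    rw [(hG t).deriv]
    linarith [hrad t ⟨ht.1, ht.2.le⟩]
  have hfin := hmono ⟨le_rfl, hr.le⟩ ⟨hr.le, le_rfl⟩ hr.le
  have hint : ∫ s in (0 : ℝ)..r, (r - s) * k s =
      r * (∫ s in (0 : ℝ)..r, k s) - ∫ s in (0 : ℝ)..r, s * k s := by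
    rw [← intervalIntegral.integral_const_mul, ← intervalIntegral.integral_sub
      (Continuous.intervalIntegrable (by fun_prop) _ _)
      (Continuous.intervalIntegrable (by fun_prop) _ _)]
    simp only [sub_mul]
  simp only [G, sphMean_zero, intervalIntegral.integral_same] at hfin
  rw [hint]
  simp at hfin
  linarith

lemma monotoneOn_sphMean (b : OrthonormalBasis ι ℝ E) {u : E → ℝ} (hu : ContDiff ℝ 2 u)
    {r : ℝ} (h0 : ∀ s ∈ Icc 0 r, 0 ≤ sphMean (normSphere μ) (lap b u) s) :
    MonotoneOn (sphMean (normSphere μ) u) (Icc 0 r) := by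
  have hu1 : ContDiff ℝ 1 u := hu.of_le one_le_two
  have hd := hasDerivAt_sphMean (normSphere μ) hu1
  refine monotoneOn_of_deriv_nonneg (convex_Icc 0 r)
    (fun t _ => (hd t).continuousAt.continuousWithinAt)
    (fun t _ => (hd t).differentiableAt.differentiableWithinAt) fun t ht => ?_
  rw [interior_Icc] at ht
  rw [(hd t).deriv]
  have hpow : 0 < t ^ (Module.finrank ℝ E - 1) := pow_pos ht.1 _
  refine nonneg_of_mul_nonneg_right ?_ hpow
  rw [pow_mul_radMean_normSphere_eq μ b hu ht.1]
  exact intervalIntegral.integral_nonneg ht.1.le fun s hs =>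
    mul_nonneg (pow_nonneg hs.1 _) (h0 s ⟨hs.1, hs.2.trans ht.2.le⟩)

/-- The growth bound for the mean `m` of `regPow δ p w` is homogeneous after `m s` is replaced by `m
r`: every term carries the factor `A = m r ^ (1 - 2 / p)`, which is positive because `δ > 0` and can
be cancelled. -/
theorem sphMean_regPow_le (b : OrthonormalBasis ι ℝ E) {w : E → H} (hw : ContDiff ℝ 2 w)
    {r c p δ : ℝ} (hr : 0 < r) (hδ : 0 < δ) (hp : 2 ≤ p) (hc : 0 ≤ c)
    (hpde : ∀ x, ‖x‖ ≤ r → 0 ≤ inner ℝ (w x) (lap b w x) ∧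
      inner ℝ (w x) (lap b w x) ≤ c * ‖w x‖ ^ 2) :
    sphMean (normSphere μ) (regPow δ p w) r ^ (2 / p) *
        (1 - p * c * r ^ 2 / (2 * Module.finrank ℝ E)) ≤
      δ + ‖w 0‖ ^ 2 + p * (p - 1) * ∫ s in (0 : ℝ)..r,
        (r - s) * sphMean (normSphere μ) (fun x => gradSq b w x ^ (p / 2)) s ^ (2 / p) := by
  set ν := normSphere μ
  set V := regPow δ p w with hVdef
  set N := Module.finrank ℝ E with hN
  set K : ℝ → ℝ := fun s => sphMean ν (fun x => gradSq b w x ^ (p / 2)) s ^ (2 / p) with hKdef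
  have hp0 : 0 < p := by linarith
  have hw1 : ContDiff ℝ 1 w := hw.of_le one_le_two
  have hV : ContDiff ℝ 2 V := contDiff_regPow hδ p hw
  have hVpos : ∀ x, 0 < V x := regPow_pos hδ p w
  have hgc : Continuous (gradSq b w) := continuous_gradSq b hw1
  have hg0 := gradSq_nonneg b w
  have hgp : Continuous fun x => gradSq b w x ^ (p / 2) :=
    hgc.rpow_const fun x => Or.inr (by positivity)
  have hbase : Continuous fun x => δ + ‖w x‖ ^ 2 := by
    have := hw.continuous
    fun_prop
  have hbp : Continuous fun x => (δ + ‖w x‖ ^ 2) ^ (p / 2 - 1) :=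
    hbase.rpow_const fun x => Or.inl (regBase_pos hδ w x).ne'
  have hK : Continuous K := (continuous_sphMean ν hgp).rpow_const fun _ => Or.inr (by positivity)
  have hK0 : ∀ s, 0 ≤ K s := fun s =>
    Real.rpow_nonneg (sphMean_nonneg (fun x => Real.rpow_nonneg (hg0 x) _) s) _
  set m := sphMean ν V with hm
  have hmpos : ∀ s, 0 < m s := sphMean_pos hV.continuous hVpos
  have hS0 : ∀ s ∈ Icc 0 r, 0 ≤ sphMean ν (lap b V) s := fun s hs => by
    have := sphMean_le_sphMean (ν := ν) continuous_const (continuous_lap b hV) hs.1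
      (fun x hx => lap_regPow_nonneg b hδ hp hw (hpde x (hx.le.trans hs.2)).1)
    simpa [sphMean] using this
  have hmono := monotoneOn_sphMean μ b hV hS0
  have hmr : ∀ s ∈ Icc 0 r, m s ≤ m r := fun s hs => hmono hs ⟨hr.le, le_rfl⟩ hs.2
  have hexp : 0 ≤ 1 - 2 / p := by
    rw [sub_nonneg, div_le_one hp0]; exact hp
  set A := m r ^ (1 - 2 / p) with hA
  have hApos : 0 < A := Real.rpow_pos_of_pos (hmpos r) _
  have hS1 : ∀ s ∈ Icc 0 r, sphMean ν (lap b V) s ≤ p * (p - 1) * A * K s + p * c * m r := by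
    intro s hs
    have h1 := sphMean_le_sphMean (ν := ν) (continuous_lap b hV)
      (g := fun x => p * (p - 1) * ((δ + ‖w x‖ ^ 2) ^ (p / 2 - 1) * gradSq b w x) + p * c * V x)
      (((hbp.mul hgc).const_mul _).add (hV.continuous.const_mul _)) hs.1
      (fun x hx => lap_regPow_le b hδ hp hc hw (hpde x (hx.le.trans hs.2)).2)
    have h2 : sphMean ν (fun x => p * (p - 1) *
        ((δ + ‖w x‖ ^ 2) ^ (p / 2 - 1) * gradSq b w x) + p * c * V x) s =
        p * (p - 1) * sphMean ν (fun x => (δ + ‖w x‖ ^ 2) ^ (p / 2 - 1) * gradSq b w x) s +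
          p * c * m s := by
      simp only [sphMean, hm]
      rw [integral_add, integral_const_mul, integral_const_mul]
      · exact integrable_sphere_smul ν ((hbp.mul hgc).const_mul _) s
      · exact integrable_sphere_smul ν (hV.continuous.const_mul _) s
    have h3 : sphMean ν (fun x => (δ + ‖w x‖ ^ 2) ^ (p / 2 - 1) * gradSq b w x) s ≤
        m s ^ (1 - 2 / p) * K s := by
      have := integral_rpow_sub_one_mul_le ν
        (F := fun ζ : sphere (0 : E) 1 => δ + ‖w (s • (ζ : E))‖ ^ 2)
        (G := fun ζ : sphere (0 : E) 1 => gradSq b w (s • (ζ : E)))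
        (hbase.comp (by fun_prop)) (hgc.comp (by fun_prop))
        (fun ζ => (regBase_pos hδ w _).le) (fun ζ => hg0 _) (s := p / 2) (by linarith)
      rw [one_div_div] at this
      exact this
    have h4 : m s ^ (1 - 2 / p) ≤ A := Real.rpow_le_rpow (hmpos s).le (hmr s hs) hexp
    have h5 : 0 ≤ p * (p - 1) := by nlinarith
    calc sphMean ν (lap b V) s
        ≤ p * (p - 1) * (m s ^ (1 - 2 / p) * K s) + p * c * m s := by
          rw [h2] at h1
          exact h1.trans (by gcongr)
      _ ≤ p * (p - 1) * (A * K s) + p * c * m r := by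
          have := hmr s hs
          have := hK0 s
          gcongr
      _ = _ := by ring
  have h5 : 0 ≤ p * (p - 1) := by nlinarith
  have hgrow := sphMean_growth μ b hV hr (k := fun s => p * (p - 1) * A * K s)
    (hK.const_mul _) (fun s => by have := hK0 s; positivity) hS1
  have hint : ∫ s in (0 : ℝ)..r, (r - s) * (p * (p - 1) * A * K s) =
      A * (p * (p - 1) * ∫ s in (0 : ℝ)..r, (r - s) * K s) := by
    rw [← intervalIntegral.integral_const_mul, ← intervalIntegral.integral_const_mul]
    congr 1
    ext s
    ring
  have hmrA : m r = A * m r ^ (2 / p) := by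
    rw [hA, ← Real.rpow_add (hmpos r)]; simp
  -- Split `V 0` as `V 0 ^ (1 - 2 / p) * V 0 ^ (2 / p)` and compare the first factor with `A`, using
  -- that `m` is increasing and `m 0 = V 0`.
  have hV0 : V 0 ≤ A * (δ + ‖w 0‖ ^ 2) := by
    have h0 := hmr 0 ⟨le_rfl, hr.le⟩
    have e : V 0 = V 0 ^ (1 - 2 / p) * (δ + ‖w 0‖ ^ 2) := by
      have : δ + ‖w 0‖ ^ 2 = V 0 ^ (2 / p) := by
        rw [hVdef, regPow, ← Real.rpow_mul (regBase_pos hδ w 0).le]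
        rw [show p / 2 * (2 / p) = 1 by field_simp, Real.rpow_one]
      conv_rhs => rw [this]
      rw [← Real.rpow_add (hVpos 0)]; simp
    rw [e]
    have h1 : V 0 ≤ m r := by rw [hm, sphMean_zero] at h0; exact h0
    have := (regBase_pos hδ w 0).le
    gcongr
    exact Real.rpow_le_rpow (hVpos 0).le h1 hexp
  rw [hint] at hgrow
  refine le_of_mul_le_mul_left ?_ hApos
  have e2 : A * (m r ^ (2 / p) * (1 - p * c * r ^ 2 / (2 * N))) =
      m r - p * c * m r * r ^ 2 / (2 * N) := by
    conv_rhs => rw [hmrA]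
    ring
  change A * (m r ^ (2 / p) * (1 - p * c * r ^ 2 / (2 * N))) ≤ _
  rw [e2]
  change m r ≤ _ at hgrow
  linarith

end RegularisedEstimate

/-! ### Difference quotients. -/

section DifferenceQuotient

variable {E : Type*} [NormedAddCommGroup E] [InnerProductSpace ℝ E]
  {F : Type*} [NormedAddCommGroup F] [NormedSpace ℝ F]

/-- The difference quotient of `u` in the direction `v` with step `h`. -/
noncomputable def diffQuot (h : ℝ) (u : E → F) (v x : E) : F := h⁻¹ • (u (x + h • v) - u x)

lemma contDiff_diffQuot (h : ℝ) {u : E → F} (v : E) {n : WithTop ℕ∞} (hu : ContDiff ℝ n u) :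
    ContDiff ℝ n (diffQuot h u v) :=
  ((hu.comp (contDiff_id.add contDiff_const)).sub hu).const_smul _

lemma fderiv_diffQuot (h : ℝ) {u : E → F} (v : E) (hu : ContDiff ℝ 1 u) (x e : E) :
    fderiv ℝ (diffQuot h u v) x e = diffQuot h (fun y => fderiv ℝ u y e) v x := by
  have h1 : ∀ y, DifferentiableAt ℝ u y := hu.differentiable one_ne_zero
  have h2 : DifferentiableAt ℝ (fun y => u (y + h • v)) x :=
    (h1 _).comp x (differentiableAt_id.add_const _)
  unfold diffQuot
  rw [fderiv_fun_const_smul (h2.fun_sub (h1 x)), fderiv_fun_sub h2 (h1 x), fderiv_comp_add_right]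
  simp

lemma tendsto_diffQuot {u : E → F} {x : E} (hu : DifferentiableAt ℝ u x) (v : E) :
    Tendsto (fun h : ℝ => diffQuot h u v x) (𝓝[>] 0) (𝓝 (fderiv ℝ u x v)) := by
  have h1 : HasDerivAt (fun t : ℝ => u (x + t • v)) (fderiv ℝ u x v) 0 :=
    hu.hasFDerivAt.hasLineDerivAt v
  have h2 := hasDerivAt_iff_tendsto_slope_zero.1 h1
  simp only [zero_add, zero_smul, add_zero] at h2
  exact h2.mono_left (nhdsWithin_mono _ fun t (ht : 0 < t) => ht.ne')

/-- Mean value inequality on the ball of radius `r + ‖v‖`, which contains all the translates with `h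
≤ 1`. Uniformity in `h` supplies the dominating constants for the limit `h → 0`. -/
lemma exists_norm_diffQuot_le [FiniteDimensional ℝ E] {u : E → F} (hu : ContDiff ℝ 1 u) (v : E)
    (r : ℝ) :
    ∃ C, 0 ≤ C ∧ ∀ h ∈ Ioc (0 : ℝ) 1, ∀ x, ‖x‖ ≤ r → ‖diffQuot h u v x‖ ≤ C := by
  obtain ⟨C, hC⟩ := (isCompact_closedBall (0 : E) (r + ‖v‖)).exists_bound_of_continuousOn
    (hu.continuous_fderiv one_ne_zero).continuousOn
  refine ⟨|C| * ‖v‖, by positivity, fun h hh x hx => ?_⟩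
  have hx1 : x ∈ closedBall (0 : E) (r + ‖v‖) := by
    rw [mem_closedBall_zero_iff]; linarith [norm_nonneg v]
  have hn : ‖h • v‖ = h * ‖v‖ := by rw [norm_smul, Real.norm_of_nonneg hh.1.le]
  have hx2 : x + h • v ∈ closedBall (0 : E) (r + ‖v‖) := by
    rw [mem_closedBall_zero_iff]
    refine (norm_add_le _ _).trans ?_
    have := mul_le_of_le_one_left (norm_nonneg v) hh.2
    linarith
  have key := (convex_closedBall (0 : E) (r + ‖v‖)).norm_image_sub_le_of_norm_fderiv_le (𝕜 := ℝ)
    (C := |C|) (fun y _ => hu.differentiable one_ne_zero y)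
    (fun y hy => (hC y hy).trans (le_abs_self C)) hx1 hx2
  rw [add_sub_cancel_left, hn] at key
  rw [diffQuot, norm_smul, norm_inv, Real.norm_of_nonneg hh.1.le, inv_mul_le_iff₀ hh.1]
  linarith

variable {ι : Type*} [Fintype ι] (b : OrthonormalBasis ι ℝ E)

lemma lap_diffQuot (h : ℝ) {u : E → F} (v : E) (hu : ContDiff ℝ 2 u) (x : E) :
    lap b (diffQuot h u v) x = diffQuot h (lap b u) v x := by
  rw [lap]
  simp only [fderiv_diffQuot h v (hu.of_le one_le_two),
    fderiv_diffQuot h v (contDiff_fderiv_const hu _)]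
  simp only [diffQuot, lap, ← Finset.smul_sum, Finset.sum_sub_distrib]

end DifferenceQuotient

/-! ### Derivatives of vector-valued maps by components. -/

section PiLp

variable {E : Type*} [NormedAddCommGroup E] [InnerProductSpace ℝ E]
  {F : Type*} [NormedAddCommGroup F] [NormedSpace ℝ F] {ι κ : Type*} [Fintype ι] [Fintype κ]

lemma fderiv_piLp_apply {w : E → PiLp 2 (fun _ : κ => F)} (hw : ContDiff ℝ 1 w) (x v : E) (i : κ) :
    fderiv ℝ w x v i = fderiv ℝ (fun y => w y i) x v := by
  have h1 := (PiLp.proj 2 (𝕜 := ℝ) (fun _ : κ => F) i).hasFDerivAt.comp x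
    (hw.differentiable one_ne_zero x).hasFDerivAt
  have h2 : HasFDerivAt (fun y => w y i) _ x := h1
  rw [h2.fderiv]
  rfl

lemma lap_piLp_apply (b : OrthonormalBasis ι ℝ E) {w : E → PiLp 2 (fun _ : κ => F)}
    (hw : ContDiff ℝ 2 w) (x : E) (i : κ) : lap b w x i = lap b (fun y => w y i) x := by
  simp only [lap, WithLp.ofLp_sum, Finset.sum_apply, fderiv_piLp_apply (contDiff_fderiv_const hw _),
    fderiv_piLp_apply (hw.of_le one_le_two)]

end PiLp

/-! ### Passage from difference quotients to the gradient. -/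

section GradientEstimate

variable {E : Type*} [NormedAddCommGroup E] [InnerProductSpace ℝ E]
  {F : Type*} [NormedAddCommGroup F] [InnerProductSpace ℝ F] {ι : Type*} [Fintype ι]
  (b : OrthonormalBasis ι ℝ E)

/-- The squared Hilbert–Schmidt norm of the second derivative of `u`. -/
noncomputable def hessSq (u : E → F) (x : E) : ℝ :=
  ∑ j, ∑ i, ‖fderiv ℝ (fun y => fderiv ℝ u y (b j)) x (b i)‖ ^ 2

/-- The vector of the difference quotients of `u` along an orthonormal basis. -/
noncomputable def gradQuot (h : ℝ) (u : E → F) (x : E) : PiLp 2 (fun _ : ι => F) :=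
  WithLp.toLp 2 fun i => diffQuot h u (b i) x

lemma contDiff_gradQuot (h : ℝ) {u : E → F} {n : WithTop ℕ∞} (hu : ContDiff ℝ n u) :
    ContDiff ℝ n (gradQuot b h u) :=
  (contDiff_piLp 2).2 fun i => contDiff_diffQuot h (b i) hu

lemma norm_sq_gradQuot (h : ℝ) (u : E → F) (x : E) :
    ‖gradQuot b h u x‖ ^ 2 = ∑ i, ‖diffQuot h u (b i) x‖ ^ 2 := by
  rw [PiLp.norm_sq_eq_of_L2]; rfl

lemma gradSq_gradQuot (h : ℝ) {u : E → F} (hu : ContDiff ℝ 2 u) (x : E) :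
    gradSq b (gradQuot b h u) x =
      ∑ j, ∑ i, ‖diffQuot h (fun y => fderiv ℝ u y (b j)) (b i) x‖ ^ 2 := by
  have hu1 : ContDiff ℝ 1 u := hu.of_le one_le_two
  simp only [gradSq, PiLp.norm_sq_eq_of_L2, fderiv_piLp_apply (contDiff_gradQuot b h hu1)]
  refine Finset.sum_congr rfl fun j _ => Finset.sum_congr rfl fun i _ => ?_
  rw [← fderiv_diffQuot h (b i) hu1]
  rfl

/-- The Laplacian commutes with translations and `L` is linear, so each difference quotient inherits
the equation from its validity at `x` and at the translated points. -/
lemma inner_gradQuot_lap (h : ℝ) {u : E → F} (hu : ContDiff ℝ 2 u) {L : F →L[ℝ] F} {x : E}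
    (hx : lap b u x = L (u x)) (hxi : ∀ i, lap b u (x + h • b i) = L (u (x + h • b i))) :
    inner ℝ (gradQuot b h u x) (lap b (gradQuot b h u) x) =
      ∑ i, inner ℝ (diffQuot h u (b i) x) (L (diffQuot h u (b i) x)) := by
  rw [PiLp.inner_apply]
  refine Finset.sum_congr rfl fun i _ => ?_
  rw [lap_piLp_apply b (contDiff_gradQuot b h hu)]
  have : lap b (fun y => gradQuot b h u y i) x = L (diffQuot h u (b i) x) := by
    change lap b (diffQuot h u (b i)) x = _
    rw [lap_diffQuot b h (b i) hu, diffQuot, hx, hxi]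
    simp [diffQuot]
  rw [this]
  rfl

variable [FiniteDimensional ℝ E] [MeasurableSpace E] [BorelSpace E]

lemma tendsto_sphMean_rpow (ν : Measure (sphere (0 : E) 1)) [IsFiniteMeasure ν]
    {l : Filter ℝ} [l.IsCountablyGenerated] {g : ℝ → E → ℝ} {g₀ : E → ℝ} {C s q : ℝ}
    (hs : 0 ≤ s) (hq : 0 ≤ q) (hc : ∀ᶠ h in l, Continuous (g h))
    (hb : ∀ᶠ h in l, ∀ x, ‖x‖ ≤ s → 0 ≤ g h x ∧ g h x ≤ C)
    (ht : ∀ x, Tendsto (fun h => g h x) l (𝓝 (g₀ x))) :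
    Tendsto (fun h => sphMean ν (fun x => g h x ^ q) s) l
      (𝓝 (sphMean ν (fun x => g₀ x ^ q) s)) := by
  refine tendsto_integral_filter_of_dominated_convergence (fun _ => C ^ q) ?_ ?_
    (integrable_const _) (.of_forall fun ζ => (ht _).rpow_const (Or.inr hq))
  · filter_upwards [hc] with h hh
    exact (integrable_sphere_smul ν (hh.rpow_const fun x => Or.inr hq) s).aestronglyMeasurable
  · filter_upwards [hb] with h hh
    refine .of_forall fun ζ => ?_
    obtain ⟨h1, h2⟩ := hh (s • (ζ : E)) (by simp [norm_smul, abs_of_nonneg hs])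
    rw [Real.norm_of_nonneg (Real.rpow_nonneg h1 _)]
    exact Real.rpow_le_rpow h1 h2 hq

variable [Nontrivial E] (μ : Measure E) [μ.IsAddHaarMeasure]

/-- The limit `h → 0⁺` of `sphMean_regPow_le` for `gradQuot b h u`, with `δ = h`, so that one
parameter drives both regularisations. -/
theorem sphMean_gradSq_le {u : E → F} (hu : ContDiff ℝ 2 u) {r R c p : ℝ}
    (hr : 0 < r) (hrR : r < R) (hp : 2 ≤ p) (hc : 0 ≤ c) {L : F →L[ℝ] F}
    (hL : ∀ y, 0 ≤ inner ℝ y (L y) ∧ inner ℝ y (L y) ≤ c * ‖y‖ ^ 2)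
    (hpde : ∀ x, ‖x‖ < R → lap b u x = L (u x)) :
    sphMean (normSphere μ) (fun x => gradSq b u x ^ (p / 2)) r ^ (2 / p) *
        (1 - p * c * r ^ 2 / (2 * Module.finrank ℝ E)) ≤
      gradSq b u 0 + p * (p - 1) * ∫ s in (0 : ℝ)..r,
        (r - s) * sphMean (normSphere μ) (fun x => hessSq b u x ^ (p / 2)) s ^ (2 / p) := by
  have hp0 : 0 < p := by linarith
  have hp2 : 0 ≤ p / 2 := by positivity
  have hp2' : 0 ≤ 2 / p := by positivity
  have hu1 : ContDiff ℝ 1 u := hu.of_le one_le_two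
  choose C₁ hC₁0 hC₁ using fun i => exists_norm_diffQuot_le hu1 (b i) r
  choose C₂ hC₂0 hC₂ using fun j i =>
    exists_norm_diffQuot_le (contDiff_fderiv_const hu (b j)) (b i) r
  set D₁ := 1 + ∑ i, C₁ i ^ 2 with hD₁
  set D₂ := ∑ j, ∑ i, C₂ j i ^ 2 with hD₂
  have hD₂0 : 0 ≤ D₂ := Finset.sum_nonneg fun j _ => Finset.sum_nonneg fun i _ => sq_nonneg _
  have hIoc : ∀ᶠ h : ℝ in 𝓝[>] 0, h ∈ Ioc (0 : ℝ) 1 := Ioc_mem_nhdsGT one_pos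
  have hid : Tendsto (fun h : ℝ => h) (𝓝[>] 0) (𝓝 0) := tendsto_nhdsWithin_of_tendsto_nhds tendsto_id
  have hcont : ∀ h, Continuous (gradSq b (gradQuot b h u)) := fun h =>
    continuous_gradSq b (contDiff_gradQuot b h hu1)
  have hb1 : ∀ h ∈ Ioc (0 : ℝ) 1, ∀ x, ‖x‖ ≤ r →
      0 ≤ h + ‖gradQuot b h u x‖ ^ 2 ∧ h + ‖gradQuot b h u x‖ ^ 2 ≤ D₁ := by
    intro h hh x hx
    refine ⟨by have := hh.1; positivity, ?_⟩
    rw [norm_sq_gradQuot]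
    refine add_le_add hh.2 (Finset.sum_le_sum fun i _ => ?_)
    exact pow_le_pow_left₀ (norm_nonneg _) (hC₁ i h hh x hx) 2
  have hb2 : ∀ h ∈ Ioc (0 : ℝ) 1, ∀ x, ‖x‖ ≤ r →
      0 ≤ gradSq b (gradQuot b h u) x ∧ gradSq b (gradQuot b h u) x ≤ D₂ := by
    intro h hh x hx
    refine ⟨gradSq_nonneg _ _ _, ?_⟩
    rw [gradSq_gradQuot b h hu]
    refine Finset.sum_le_sum fun j _ => Finset.sum_le_sum fun i _ => ?_
    exact pow_le_pow_left₀ (norm_nonneg _) (hC₂ j i h hh x hx) 2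
  have ht1 : ∀ x, Tendsto (fun h => h + ‖gradQuot b h u x‖ ^ 2) (𝓝[>] 0) (𝓝 (gradSq b u x)) := by
    intro x
    simp only [norm_sq_gradQuot, gradSq]
    have := hid.add (tendsto_finsetSum Finset.univ fun i _ =>
      ((tendsto_diffQuot (hu1.differentiable one_ne_zero x) (b i)).norm.pow 2))
    simpa using this
  have ht2 : ∀ x, Tendsto (fun h => gradSq b (gradQuot b h u) x) (𝓝[>] 0) (𝓝 (hessSq b u x)) := by
    intro x
    simp only [gradSq_gradQuot b _ hu, hessSq]
    exact tendsto_finsetSum _ fun j _ => tendsto_finsetSum _ fun i _ => ((tendsto_diffQuot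
      ((contDiff_fderiv_const hu (b j)).differentiable one_ne_zero x) (b i)).norm.pow 2)
  have hmain : ∀ᶠ h : ℝ in 𝓝[>] 0,
      sphMean (normSphere μ) (regPow h p (gradQuot b h u)) r ^ (2 / p) *
        (1 - p * c * r ^ 2 / (2 * Module.finrank ℝ E)) ≤
      h + ‖gradQuot b h u 0‖ ^ 2 + p * (p - 1) * ∫ s in (0 : ℝ)..r,
        (r - s) * sphMean (normSphere μ)
          (fun x => gradSq b (gradQuot b h u) x ^ (p / 2)) s ^ (2 / p) := by
    -- The margin `R - r` keeps the translates by `h • b i` inside the ball where the equation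
    -- holds.
    have hlt : ∀ᶠ h : ℝ in 𝓝[>] 0, h < R - r := hid.eventually_lt_const (by linarith)
    filter_upwards [self_mem_nhdsWithin, hlt] with h hh hh'
    have hh0 : 0 < h := hh
    refine sphMean_regPow_le μ b (contDiff_gradQuot b h hu) hr hh0 hp hc fun x hx => ?_
    have hball : ∀ i, ‖x + h • b i‖ < R := fun i => by
      refine (norm_add_le _ _).trans_lt ?_
      rw [norm_smul, b.orthonormal.1 i, Real.norm_of_nonneg hh0.le]
      linarith
    rw [inner_gradQuot_lap b h hu (hpde x (by linarith)) fun i => hpde _ (hball i),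
      norm_sq_gradQuot, Finset.mul_sum]
    exact ⟨Finset.sum_nonneg fun i _ => (hL _).1, Finset.sum_le_sum fun i _ => (hL _).2⟩
  refine le_of_tendsto_of_tendsto ?_ ?_ hmain
  · refine Tendsto.mul_const _ (Tendsto.rpow_const ?_ (Or.inr hp2'))
    refine tendsto_sphMean_rpow (normSphere μ) (g := fun h x => h + ‖gradQuot b h u x‖ ^ 2)
      (C := D₁) hr.le hp2 (.of_forall fun h => ?_) (hIoc.mono hb1) ht1
    have := (contDiff_gradQuot b h hu1).continuous
    fun_prop
  · refine (ht1 0).add (Tendsto.const_mul _ ?_)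
    refine intervalIntegral.tendsto_integral_filter_of_dominated_convergence
      (fun _ => r * D₂) ?_ ?_ intervalIntegrable_const ?_
    · refine .of_forall fun h => Continuous.aestronglyMeasurable ?_
      have := continuous_sphMean (normSphere μ)
        ((hcont h).rpow_const (p := p / 2) fun x => Or.inr hp2)
      exact (continuous_const.sub continuous_id).mul (this.rpow_const fun _ => Or.inr hp2')
    · filter_upwards [hIoc] with h hh
      refine .of_forall fun s hs => ?_
      rw [uIoc_of_le hr.le] at hs
      have h0 : 0 ≤ sphMean (normSphere μ) (fun x => gradSq b (gradQuot b h u) x ^ (p / 2)) s :=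
        sphMean_nonneg (fun x => Real.rpow_nonneg (gradSq_nonneg _ _ _) _) s
      have h1 : sphMean (normSphere μ) (fun x => gradSq b (gradQuot b h u) x ^ (p / 2)) s ≤
          D₂ ^ (p / 2) := by
        have := sphMean_le_sphMean (ν := normSphere μ)
          ((hcont h).rpow_const (p := p / 2) fun x => Or.inr hp2)
          (continuous_const (y := D₂ ^ (p / 2))) hs.1.le fun x hx =>
            Real.rpow_le_rpow (gradSq_nonneg _ _ _) (hb2 h hh x (hx.le.trans hs.2)).2 hp2
        simpa [sphMean] using this
      have h2 : sphMean (normSphere μ) (fun x => gradSq b (gradQuot b h u) x ^ (p / 2)) s ^ (2 / p)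
          ≤ D₂ := by
        refine (Real.rpow_le_rpow h0 h1 hp2').trans_eq ?_
        rw [← Real.rpow_mul hD₂0, show p / 2 * (2 / p) = 1 by field_simp, Real.rpow_one]
      have h3 : 0 ≤ r - s := by linarith [hs.2]
      rw [Real.norm_of_nonneg (mul_nonneg h3 (Real.rpow_nonneg h0 _))]
      exact mul_le_mul (by linarith [hs.1]) h2 (Real.rpow_nonneg h0 _) hr.le
    · refine .of_forall fun s hs => ?_
      rw [uIoc_of_le hr.le] at hs
      refine Tendsto.const_mul _ (Tendsto.rpow_const ?_ (Or.inr hp2'))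
      refine tendsto_sphMean_rpow (normSphere μ) (C := D₂) hs.1.le hp2 (.of_forall hcont) ?_ ht2
      exact hIoc.mono fun h hh x hx => hb2 h hh x (hx.trans hs.2)

end GradientEstimate

/-! ### Growth of a function controlled by its gradient. -/

section Growth

variable {E : Type*} [NormedAddCommGroup E] [InnerProductSpace ℝ E]
  {F : Type*} [NormedAddCommGroup F] [InnerProductSpace ℝ F] {ι : Type*} [Fintype ι]
  (b : OrthonormalBasis ι ℝ E)

lemma norm_sq_fderiv_apply_le (u : E → F) (x y : E) :
    ‖fderiv ℝ u x y‖ ^ 2 ≤ gradSq b u x * ‖y‖ ^ 2 := by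
  have h1 : fderiv ℝ u x y = ∑ i, inner ℝ (b i) y • fderiv ℝ u x (b i) := by
    conv_lhs => rw [← b.sum_repr' y]
    simp
  have h2 : ‖fderiv ℝ u x y‖ ≤ ∑ i, ‖inner ℝ (b i) y‖ * ‖fderiv ℝ u x (b i)‖ := by
    rw [h1]
    exact (norm_sum_le _ _).trans_eq (Finset.sum_congr rfl fun i _ => norm_smul _ _)
  calc ‖fderiv ℝ u x y‖ ^ 2 ≤ (∑ i, ‖inner ℝ (b i) y‖ * ‖fderiv ℝ u x (b i)‖) ^ 2 :=
        pow_le_pow_left₀ (norm_nonneg _) h2 2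
    _ ≤ (∑ i, ‖inner ℝ (b i) y‖ ^ 2) * ∑ i, ‖fderiv ℝ u x (b i)‖ ^ 2 :=
        Finset.sum_mul_sq_le_sq_mul_sq _ _ _
    _ = gradSq b u x * ‖y‖ ^ 2 := by rw [b.sum_sq_norm_inner_right, gradSq, mul_comm]

variable [FiniteDimensional ℝ E] [MeasurableSpace E] [BorelSpace E]

/-- With `a = √(1 + |u|²)`, the radial derivative of `a^p` is at most `p a^(p-1)|∇u|`; Hölder with
exponent `p` finishes. -/
lemma radMean_regPow_le (ν : Measure (sphere (0 : E) 1)) [IsFiniteMeasure ν] {u : E → F}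
    (hu : ContDiff ℝ 1 u) {p : ℝ} (hp : 1 ≤ p) (t : ℝ) :
    radMean ν (regPow 1 p u) t ≤ p * (sphMean ν (regPow 1 p u) t ^ (1 - 1 / p) *
      sphMean ν (fun x => gradSq b u x ^ (p / 2)) t ^ (1 / p)) := by
  have hbase : Continuous fun x => √(1 + ‖u x‖ ^ 2) := by
    have := hu.continuous
    fun_prop
  have hgrad : Continuous fun x => √(gradSq b u x) := (continuous_gradSq b hu).sqrt
  have hrpow : ∀ (a q : ℝ), 0 ≤ a → √a ^ q = a ^ (q / 2) := fun a q ha => by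
    rw [Real.sqrt_eq_rpow, ← Real.rpow_mul ha]; congr 1; ring
  have hold := integral_rpow_sub_one_mul_le ν
    (F := fun ζ : sphere (0 : E) 1 => √(1 + ‖u (t • (ζ : E))‖ ^ 2))
    (G := fun ζ : sphere (0 : E) 1 => √(gradSq b u (t • (ζ : E))))
    (hbase.comp (by fun_prop)) (hgrad.comp (by fun_prop))
    (fun ζ => Real.sqrt_nonneg _) (fun ζ => Real.sqrt_nonneg _) hp
  simp only [fun ζ : sphere (0 : E) 1 => hrpow _ p (regBase_pos one_pos u (t • (ζ : E))).le,
    fun ζ : sphere (0 : E) 1 => hrpow _ p (gradSq_nonneg b u (t • (ζ : E)))] at hold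
  refine le_trans ?_ (mul_le_mul_of_nonneg_left hold (by linarith))
  rw [← integral_const_mul]
  have hV : ContDiff ℝ 1 (regPow 1 p u) := contDiff_regPow one_pos p hu
  refine integral_mono (integrable_sphere_of_continuous ν ?_)
    (integrable_sphere_of_continuous ν ?_) fun ζ => ?_
  · exact ((hV.continuous_fderiv one_ne_zero).comp (by fun_prop)).clm_apply (by fun_prop)
  · exact continuous_const.mul (((hbase.rpow_const fun x => Or.inr (by linarith)).mul hgrad).comp
      (by fun_prop : Continuous fun ζ : sphere (0 : E) 1 => t • (ζ : E)))
  · simp only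
    set x := t • (ζ : E)
    rw [fderiv_regPow one_pos p hu]
    set a := √(1 + ‖u x‖ ^ 2) with ha
    have ha0 : 0 < a := Real.sqrt_pos.2 (regBase_pos one_pos u x)
    have h1 : (1 + ‖u x‖ ^ 2) ^ (p / 2 - 1) = a ^ (p - 2) := by
      rw [hrpow _ _ (regBase_pos one_pos u x).le]; congr 1; ring
    have h2 : a ^ (p - 1) = a ^ (p - 2) * a := by
      rw [← Real.rpow_add_one ha0.ne']; congr 1; ring
    have h3 : ‖u x‖ ≤ a := Real.le_sqrt_of_sq_le (by linarith)
    have h4 : ‖fderiv ℝ u x ζ‖ ≤ √(gradSq b u x) := by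
      refine Real.le_sqrt_of_sq_le ?_
      simpa using norm_sq_fderiv_apply_le b u x (ζ : E)
    have h5 : inner ℝ (u x) (fderiv ℝ u x ζ) ≤ a * √(gradSq b u x) :=
      (real_inner_le_norm _ _).trans (mul_le_mul h3 h4 (norm_nonneg _) ha0.le)
    rw [h1, h2]
    calc p * a ^ (p - 2) * inner ℝ (u x) (fderiv ℝ u x ζ)
        ≤ p * a ^ (p - 2) * (a * √(gradSq b u x)) := by gcongr
      _ = _ := by ring

lemma sphMean_regPow_growth (ν : Measure (sphere (0 : E) 1)) [IsProbabilityMeasure ν] {u : E → F}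
    (hu : ContDiff ℝ 1 u) {p r C : ℝ} (hp : 1 ≤ p) (hr : r ∈ Ioo (0 : ℝ) 1) (hC : 0 ≤ C)
    (hle : ∀ t ∈ Ioo 0 r, sphMean ν (fun x => gradSq b u x ^ (p / 2)) t ^ (1 / p) ≤ C / √(1 - t)) :
    sphMean ν (regPow 1 p u) r ^ (1 / p) ≤ regPow 1 p u 0 ^ (1 / p) + 2 * C := by
  have hp0 : 0 < p := by linarith
  have hV : ContDiff ℝ 1 (regPow 1 p u) := contDiff_regPow one_pos p hu
  set J := sphMean ν (regPow 1 p u) with hJ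
  have hJpos : ∀ t, 0 < J t := sphMean_pos hV.continuous (regPow_pos one_pos p u)
  -- The derivative of `J^(1/p)` is at most `C / √(1 - t)`, whose primitive is `-2C√(1 - t)`; hence
  -- `Q` decreases. Taking `δ = 1` keeps `J` positive, so the root is differentiable.
  set Q : ℝ → ℝ := fun t => J t ^ (1 / p) + 2 * C * √(1 - t)
  have hQ : ∀ t < 1, HasDerivAt Q (radMean ν (regPow 1 p u) t * (1 / p) * J t ^ (1 / p - 1) +
      2 * C * (-1 / (2 * √(1 - t)))) t := by
    intro t ht
    have h1 := (hasDerivAt_sphMean ν hV t).rpow_const (p := 1 / p) (Or.inl (hJpos t).ne')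
    have h2 := (((hasDerivAt_id t).const_sub 1).sqrt (by simp; linarith)).const_mul (2 * C)
    exact h1.add h2
  have hanti : AntitoneOn Q (Icc 0 r) := by
    refine antitoneOn_of_deriv_nonpos (convex_Icc 0 r)
      (fun t ht => (hQ t (ht.2.trans_lt hr.2)).continuousAt.continuousWithinAt)
      (fun t ht => ?_) fun t ht => ?_
    all_goals rw [interior_Icc] at ht
    · exact (hQ t (ht.2.trans hr.2)).differentiableAt.differentiableWithinAt
    · rw [(hQ t (ht.2.trans hr.2)).deriv]
      have h1 := radMean_regPow_le b ν hu hp t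
      have h2 := hle t ht
      have h3 : radMean ν (regPow 1 p u) t * (1 / p) * J t ^ (1 / p - 1) ≤ C / √(1 - t) := by
        have h4 : 0 < 1 / p * J t ^ (1 / p - 1) :=
          mul_pos (by positivity) (Real.rpow_pos_of_pos (hJpos t) _)
        have h5 : J t ^ (1 - 1 / p) * J t ^ (1 / p - 1) = 1 := by
          rw [← Real.rpow_add (hJpos t)]; simp
        calc radMean ν (regPow 1 p u) t * (1 / p) * J t ^ (1 / p - 1)
            = radMean ν (regPow 1 p u) t * (1 / p * J t ^ (1 / p - 1)) := by ring
          _ ≤ p * (J t ^ (1 - 1 / p) * sphMean ν (fun x => gradSq b u x ^ (p / 2)) t ^ (1 / p)) *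
              (1 / p * J t ^ (1 / p - 1)) := mul_le_mul_of_nonneg_right h1 h4.le
          _ = (J t ^ (1 - 1 / p) * J t ^ (1 / p - 1)) *
              sphMean ν (fun x => gradSq b u x ^ (p / 2)) t ^ (1 / p) := by
            field_simp
          _ ≤ _ := by rw [h5, one_mul]; exact h2
      have h6 : 0 < √(1 - t) := Real.sqrt_pos.2 (by linarith [ht.2, hr.2])
      have h7 : 2 * C * (-1 / (2 * √(1 - t))) = - (C / √(1 - t)) := by field_simp
      linarith
  have hfin := hanti ⟨le_rfl, hr.1.le⟩ ⟨hr.1.le, le_rfl⟩ hr.1.le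
  simp only [Q, hJ, sphMean_zero, sub_zero, Real.sqrt_one, mul_one] at hfin
  have : 0 ≤ 2 * C * √(1 - r) := by positivity
  linarith

end Growth

/-! ### Wirtinger derivatives and integral means in real terms. -/

section ComplexSpace

variable {n : ℕ}

/-- The real orthonormal basis of `ℂⁿ` consisting of the vectors `e_k` and `i e_k`. -/
noncomputable def realBasis (n : ℕ) : OrthonormalBasis ((_ : Fin n) × Fin 2) ℝ (Cn n) :=
  Pi.orthonormalBasis fun _ : Fin n => Complex.orthonormalBasisOneI

lemma realBasis_zero (k : Fin n) : realBasis n ⟨k, 0⟩ = EuclideanSpace.single k (1 : ℂ) := by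
  simp [realBasis]

lemma realBasis_one (k : Fin n) : realBasis n ⟨k, 1⟩ = EuclideanSpace.single k Complex.I := by
  simp [realBasis]

lemma sum_realBasis {A : Type*} [AddCommMonoid A] (g : Cn n → A) :
    ∑ i, g (realBasis n i) =
      ∑ k, (g (EuclideanSpace.single k (1 : ℂ)) + g (EuclideanSpace.single k Complex.I)) := by
  rw [Fintype.sum_sigma]
  simp only [Fin.sum_univ_two, realBasis_zero, realBasis_one]

lemma finrank_Cn : Module.finrank ℝ (Cn n) = 2 * n := by
  rw [Module.finrank_eq_card_basis (realBasis n).toBasis]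
  simp [mul_comm]

/-- The parallelogram law. Each passage from real to Wirtinger derivatives costs a factor `1/2`:
once in `normD_sq`, twice in `normD2_sq`. -/
lemma norm_sq_wirtinger (a c : ℂ) :
    ‖(1 / 2 : ℂ) * (a - Complex.I * c)‖ ^ 2 + ‖(1 / 2 : ℂ) * (a + Complex.I * c)‖ ^ 2 =
      (1 / 2) * (‖a‖ ^ 2 + ‖c‖ ^ 2) := by
  simp only [norm_mul, mul_pow]
  have := parallelogram_law_with_norm ℝ a (Complex.I * c)
  have h : ‖Complex.I * c‖ = ‖c‖ := by simp
  rw [h] at this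
  norm_num
  linarith

lemma normD_sq (u : Cn n → ℂ) (z : Cn n) : normD u z ^ 2 = (1 / 2) * gradSq (realBasis n) u z := by
  rw [normD, Real.sq_sqrt (Finset.sum_nonneg fun k _ => by positivity), gradSq,
    sum_realBasis fun v => ‖fderiv ℝ u z v‖ ^ 2, Finset.mul_sum]
  exact Finset.sum_congr rfl fun k _ => norm_sq_wirtinger _ _

lemma fderiv_wirtinger {a c : Cn n → ℂ} {z : Cn n} (ha : DifferentiableAt ℝ a z)
    (hc : DifferentiableAt ℝ c z) (ε : ℂ) (v : Cn n) :
    fderiv ℝ (fun y => (1 / 2 : ℂ) * (a y + ε * c y)) z v =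
      (1 / 2 : ℂ) * (fderiv ℝ a z v + ε * fderiv ℝ c z v) := by
  rw [fderiv_const_mul (ha.fun_add (hc.const_mul ε)), fderiv_fun_add ha (hc.const_mul ε),
    fderiv_const_mul hc]
  simp [mul_add]

lemma normD2_sq {u : Cn n → ℂ} (hu : ContDiff ℝ 2 u) (z : Cn n) :
    normD2 u z ^ 2 = (1 / 4) * hessSq (realBasis n) u z := by
  have hd : ∀ v, DifferentiableAt ℝ (fun y => fderiv ℝ u y v) z := fun v =>
    (contDiff_fderiv_const hu v).differentiable one_ne_zero z
  have hsub : ∀ k, partialZ k u = fun y => (1 / 2 : ℂ) * (partialX k u y + (-Complex.I) * partialY k u y) := by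
    intro k; ext y; simp [partialZ, sub_eq_add_neg]
  have hadd : ∀ k, partialZbar k u =
      fun y => (1 / 2 : ℂ) * (partialX k u y + Complex.I * partialY k u y) := fun k => rfl
  have key : ∀ k v, ‖fderiv ℝ (partialZ k u) z v‖ ^ 2 + ‖fderiv ℝ (partialZbar k u) z v‖ ^ 2 =
      (1 / 2) * (‖fderiv ℝ (partialX k u) z v‖ ^ 2 + ‖fderiv ℝ (partialY k u) z v‖ ^ 2) := by
    intro k v
    have hX : DifferentiableAt ℝ (partialX k u) z := hd _
    have hY : DifferentiableAt ℝ (partialY k u) z := hd _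
    rw [hsub, hadd, fderiv_wirtinger hX hY, fderiv_wirtinger hX hY, neg_mul, ← sub_eq_add_neg,
      norm_sq_wirtinger]
  have hk : ∀ j k, ‖partialZ j (partialZ k u) z‖ ^ 2 + ‖partialZbar j (partialZ k u) z‖ ^ 2
      + ‖partialZ j (partialZbar k u) z‖ ^ 2 + ‖partialZbar j (partialZbar k u) z‖ ^ 2 =
      (1 / 4) * ((‖partialX j (partialX k u) z‖ ^ 2 + ‖partialY j (partialX k u) z‖ ^ 2) +
        (‖partialX j (partialY k u) z‖ ^ 2 + ‖partialY j (partialY k u) z‖ ^ 2)) := by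
    intro j k
    have h1 := norm_sq_wirtinger (partialX j (partialZ k u) z) (partialY j (partialZ k u) z)
    have h2 := norm_sq_wirtinger (partialX j (partialZbar k u) z) (partialY j (partialZbar k u) z)
    have h3 := key k (EuclideanSpace.single j (1 : ℂ))
    have h4 := key k (EuclideanSpace.single j Complex.I)
    simp only [partialZ, partialZbar] at h1 h2 ⊢
    simp only [partialX, partialY] at h1 h2 h3 h4 ⊢
    linarith
  rw [normD2, Real.sq_sqrt (Finset.sum_nonneg fun k _ => Finset.sum_nonneg fun j _ => by positivity),
    hessSq, sum_realBasis fun w => ∑ i, ‖fderiv ℝ (fun y => fderiv ℝ u y w) z (realBasis n i)‖ ^ 2,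
    -- In `normD2` the inner index belongs to the derivative taken first, in `hessSq` the outer one.
    Finset.sum_comm, Finset.mul_sum]
  refine Finset.sum_congr rfl fun k _ => ?_
  rw [sum_realBasis fun v => ‖fderiv ℝ (fun y => fderiv ℝ u y (EuclideanSpace.single k 1)) z v‖ ^ 2,
    sum_realBasis fun v =>
      ‖fderiv ℝ (fun y => fderiv ℝ u y (EuclideanSpace.single k Complex.I)) z v‖ ^ 2,
    ← Finset.sum_add_distrib, Finset.mul_sum]
  exact Finset.sum_congr rfl fun j _ => hk j k

lemma laplacian_eq_lap {u : Cn n → ℂ} (hu : ContDiff ℝ 2 u) (z : Cn n) :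
    Laplacian.laplacian u z = lap (realBasis n) u z := by
  rw [InnerProductSpace.laplacian_eq_iteratedFDeriv_orthonormalBasis u (realBasis n), lap]
  refine Finset.sum_congr rfl fun i _ => ?_
  have h : DifferentiableAt ℝ (fderiv ℝ u) z :=
    (hu.fderiv_right (m := 1) (by norm_num)).differentiable one_ne_zero z
  rw [iteratedFDeriv_two_apply, fderiv_clm_apply h (differentiableAt_const _)]
  simp

/-- A `C^m` function on a ball agrees, on a smaller ball, with a function that is `C^m` everywhere. -/
lemma exists_contDiff_eqOn_ball {E F : Type*} [NormedAddCommGroup E] [InnerProductSpace ℝ E]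
    [FiniteDimensional ℝ E] [NormedAddCommGroup F] [NormedSpace ℝ F] {m : ℕ} {u : E → F}
    {R S : ℝ} (hR : 0 < R) (hRS : R < S) (hu : ContDiffOn ℝ m u (ball 0 S)) :
    ∃ v : E → F, ContDiff ℝ m v ∧ EqOn v u (ball 0 R) := by
  let χ : ContDiffBump (0 : E) := ⟨R, (R + S) / 2, hR, by linarith⟩
  refine ⟨fun x => χ x • u x, ?_, fun x hx => ?_⟩
  · rw [contDiff_iff_contDiffAt]
    intro x
    by_cases hx : x ∈ ball (0 : E) S
    · exact χ.contDiff.contDiffAt.smul (hu.contDiffAt (isOpen_ball.mem_nhds hx))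
    · have hx' : x ∉ tsupport χ := by
        rw [χ.tsupport_eq, mem_closedBall_zero_iff]
        rw [mem_ball_zero_iff] at hx
        change ¬ ‖x‖ ≤ (R + S) / 2
        linarith
      have : (fun y => χ y • u y) =ᶠ[𝓝 x] fun _ => 0 := by
        filter_upwards [notMem_tsupport_iff_eventuallyEq.1 hx'] with y hy
        simp [hy]
      exact contDiffAt_const.congr_of_eventuallyEq this
  · have : χ x = 1 := χ.one_of_mem_closedBall (ball_subset_closedBall hx)
    simp [this]

lemma normD_congr {u v : Cn n → ℂ} {z : Cn n} (h : u =ᶠ[𝓝 z] v) : normD u z = normD v z := by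
  simp only [normD, partialZ, partialZbar, partialX, partialY, h.fderiv_eq]

lemma normD2_congr {u v : Cn n → ℂ} {z : Cn n} (h : u =ᶠ[𝓝 z] v) : normD2 u z = normD2 v z := by
  have h1 : ∀ k, partialZ k u =ᶠ[𝓝 z] partialZ k v := fun k => by
    filter_upwards [h.fderiv (𝕜 := ℝ)] with y hy
    simp only [partialZ, partialX, partialY, hy]
  have h2 : ∀ k, partialZbar k u =ᶠ[𝓝 z] partialZbar k v := fun k => by
    filter_upwards [h.fderiv (𝕜 := ℝ)] with y hy
    simp only [partialZbar, partialX, partialY, hy]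
  have h3 : ∀ k, fderiv ℝ (partialZ k u) z = fderiv ℝ (partialZ k v) z := fun k => (h1 k).fderiv_eq
  have h4 : ∀ k, fderiv ℝ (partialZbar k u) z = fderiv ℝ (partialZbar k v) z :=
    fun k => (h2 k).fderiv_eq
  have hX : ∀ j k, partialZ j (partialZ k u) z = partialZ j (partialZ k v) z := fun j k => by
    rw [partialZ, partialX, partialY, h3]; rfl
  have hX2 : ∀ j k, partialZbar j (partialZ k u) z = partialZbar j (partialZ k v) z := fun j k => by
    rw [partialZbar, partialX, partialY, h3]; rfl
  have hX3 : ∀ j k, partialZ j (partialZbar k u) z = partialZ j (partialZbar k v) z := fun j k => by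
    rw [partialZ, partialX, partialY, h4]; rfl
  have hX4 : ∀ j k, partialZbar j (partialZbar k u) z = partialZbar j (partialZbar k v) z :=
    fun j k => by rw [partialZbar, partialX, partialY, h4]; rfl
  simp only [normD2, hX, hX2, hX3, hX4]

lemma integralMean_congr {F : Type*} [NormedAddCommGroup F] {p r : ℝ} (hr : 0 ≤ r) {g h : Cn n → F}
    (hgh : ∀ z, ‖z‖ = r → g z = h z) : integralMean p r g = integralMean p r h := by
  unfold integralMean
  congr 1
  refine integral_congr_ae (.of_forall fun ζ => ?_)
  simp only
  rw [hgh _ (by simp [norm_smul, abs_of_nonneg hr])]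

lemma integralMean_nonneg {F : Type*} [NormedAddCommGroup F] (p r : ℝ) (g : Cn n → F) :
    0 ≤ integralMean p r g :=
  Real.rpow_nonneg (integral_nonneg fun _ => Real.rpow_nonneg (norm_nonneg _) _) _

lemma integralMean_sq_eq {p : ℝ} (hp : 0 < p) (r : ℝ) {a : ℝ} (ha : 0 ≤ a) {g G : Cn n → ℝ}
    (hG : ∀ z, 0 ≤ G z) (h : ∀ z, g z ^ 2 = a * G z) :
    integralMean p r g ^ 2 =
      a * sphMean (normSphere volume) (fun z => G z ^ (p / 2)) r ^ (2 / p) := by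
  have hpt : ∀ z, ‖g z‖ ^ p = a ^ (p / 2) * G z ^ (p / 2) := fun z => by
    rw [← Real.mul_rpow ha (hG z), ← h z, ← sq_abs, ← Real.rpow_natCast |g z|, ← Real.rpow_mul (abs_nonneg _), Real.norm_eq_abs]
    congr 1; push_cast; ring
  have hint : ∫ ζ : sphere (0 : Cn n) 1, ‖g (r • (ζ : Cn n))‖ ^ p ∂(sphereMeasure n) =
      a ^ (p / 2) * sphMean (normSphere volume) (fun z => G z ^ (p / 2)) r := by
    simp only [hpt, integral_const_mul]
    -- `sphereMeasure n` unfolds to `normSphere volume`.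
    rfl
  have h0 : 0 ≤ sphMean (normSphere volume) (fun z => G z ^ (p / 2)) r :=
    sphMean_nonneg (fun z => Real.rpow_nonneg (hG z) _) r
  rw [integralMean, hint, ← Real.rpow_natCast, ← Real.rpow_mul (by positivity),
    Real.mul_rpow (by positivity) h0, ← Real.rpow_mul ha]
  congr 1
  · rw [show p / 2 * (1 / p * ((2 : ℕ) : ℝ)) = 1 by push_cast; field_simp, Real.rpow_one]
  · congr 1; push_cast; ring

end ComplexSpace

/-! ### Majorants. -/

namespace IsMajorant

variable {ω : ℝ → ℝ}

lemma le_mul (hω : IsMajorant ω) {x : ℝ} (hx : 1 ≤ x) : ω x ≤ ω 1 * x := by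
  have hx0 : 0 < x := by linarith
  have := hω.antitoneOn_div (mem_Ioi.2 one_pos) (mem_Ioi.2 hx0) hx
  simp only [div_one] at this
  exact (div_le_iff₀ hx0).1 this

lemma continuousOn_comp (hω : IsMajorant ω) {r : ℝ} (hr : r < 1) :
    ContinuousOn (fun s => ω (1 / (1 - s))) (Icc 0 r) := by
  refine hω.continuousOn.comp (ContinuousOn.div continuousOn_const (by fun_prop) ?_) ?_
  · intro s hs
    linarith [hs.2]
  · intro s hs
    have : 0 < 1 - s := by linarith [hs.2]
    exact mem_Ici.2 (by positivity)

lemma nonneg_comp (hω : IsMajorant ω) {s : ℝ} (hs : s < 1) : 0 ≤ ω (1 / (1 - s)) :=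
  hω.nonneg _ (one_div_nonneg.2 (by linarith))

/-- One of the two factors `ω` is absorbed by the weight: `(r-s) ω(1/(1-s)) ≤ (1-s) ω(1/(1-s)) ≤
ω(1)`. -/
lemma sub_mul_sq_le (hω : IsMajorant ω) {r s : ℝ} (hr : r < 1) (hs : s ∈ Icc 0 r) :
    (r - s) * ω (1 / (1 - s)) ^ 2 ≤ ω 1 * ω (1 / (1 - s)) := by
  have h1 : 0 < 1 - s := by linarith [hs.2]
  have h2 := hω.le_mul (x := 1 / (1 - s)) ((one_le_div h1).2 (by linarith [hs.1]))
  have h0 : 0 ≤ ω (1 / (1 - s)) := hω.nonneg_comp (by linarith)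
  have h3 : (1 - s) * ω (1 / (1 - s)) ≤ ω 1 := by
    calc (1 - s) * ω (1 / (1 - s)) ≤ (1 - s) * (ω 1 * (1 / (1 - s))) := by gcongr
      _ = ω 1 := by field_simp
  have h4 : (r - s) * ω (1 / (1 - s)) ≤ ω 1 :=
    (mul_le_mul_of_nonneg_right (by linarith) h0).trans h3
  calc (r - s) * ω (1 / (1 - s)) ^ 2 = ((r - s) * ω (1 / (1 - s))) * ω (1 / (1 - s)) := by ring
    _ ≤ _ := by gcongr

lemma integral_comp_mul (ω : ℝ → ℝ) (r : ℝ) :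
    ∫ s in (0 : ℝ)..r, ω (1 / (1 - s)) = r * ∫ t in (0 : ℝ)..1, ω (1 / (1 - r * t)) := by
  have := intervalIntegral.mul_integral_comp_mul_left (a := 0) (b := 1)
    (f := fun s => ω (1 / (1 - s))) r
  rw [this]
  simp

lemma integral_nonneg_comp (hω : IsMajorant ω) {r : ℝ} (hr : r ∈ Ioo (0 : ℝ) 1) :
    0 ≤ ∫ t in (0 : ℝ)..1, ω (1 / (1 - r * t)) :=
  intervalIntegral.integral_nonneg zero_le_one fun t ht =>
    hω.nonneg_comp (by nlinarith [hr.1, hr.2, ht.1, ht.2])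

/-- A crude bound by the largest value of the integrand; it suffices because its square root is
integrable up to `r = 1`. -/
lemma integral_le_div (hω : IsMajorant ω) {r : ℝ} (hr : r ∈ Ioo (0 : ℝ) 1) :
    ∫ t in (0 : ℝ)..1, ω (1 / (1 - r * t)) ≤ ω 1 / (1 - r) := by
  have hr1 : 0 < 1 - r := by linarith [hr.2]
  have hmaps : ∀ t ∈ Icc (0 : ℝ) 1, r * t ∈ Icc 0 r := fun t ht =>
    ⟨mul_nonneg hr.1.le ht.1, by nlinarith [hr.1, ht.2]⟩
  have hcont : ContinuousOn (fun t => ω (1 / (1 - r * t))) (Icc 0 1) :=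
    (hω.continuousOn_comp hr.2).comp (f := fun t : ℝ => r * t) (by fun_prop) hmaps
  have := intervalIntegral.integral_mono_on (μ := volume) (g := fun _ => ω 1 / (1 - r)) zero_le_one
    (hcont.intervalIntegrable_of_Icc zero_le_one) intervalIntegrable_const fun t ht => by
      have h1 := (hmaps t ht).2
      have h2 := (hmaps t ht).1
      have h3 : 1 / (1 - r * t) ≤ 1 / (1 - r) := by gcongr
      have h4 : (1 : ℝ) ≤ 1 / (1 - r) := (one_le_div hr1).2 (by linarith [hr.1])
      have h5 : 0 ≤ 1 / (1 - r * t) := one_div_nonneg.2 (by linarith)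
      calc ω (1 / (1 - r * t)) ≤ ω (1 / (1 - r)) :=
            hω.monotoneOn (mem_Ici.2 h5) (mem_Ici.2 (by linarith)) h3
        _ ≤ ω 1 * (1 / (1 - r)) := hω.le_mul h4
        _ = ω 1 / (1 - r) := by ring
  simpa using this

end IsMajorant

/-! ### The two conclusions on the unit ball. -/

section Estimates

variable {n : ℕ}

/-- The zeroth order term `y ↦ τ y + η Re y` as a real linear map. -/
noncomputable def zerothOrder (τ η : ℝ) : ℂ →L[ℝ] ℂ :=
  τ • ContinuousLinearMap.id ℝ ℂ + η • (Complex.ofRealCLM.comp Complex.reCLM)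

lemma zerothOrder_apply (τ η : ℝ) (y : ℂ) :
    zerothOrder τ η y = (τ : ℂ) * y + (η : ℂ) * (y.re : ℂ) := by
  simp [zerothOrder]

/-- The inner product equals `τ|y|² + η(Re y)²`. -/
lemma inner_zerothOrder {τ η : ℝ} (hτ : 0 ≤ τ) (hη : 0 ≤ η) (y : ℂ) :
    0 ≤ inner ℝ y (zerothOrder τ η y) ∧ inner ℝ y (zerothOrder τ η y) ≤ (η + τ) * ‖y‖ ^ 2 := by
  have h1 : inner ℝ y (zerothOrder τ η y) = τ * ‖y‖ ^ 2 + η * y.re ^ 2 := by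
    rw [zerothOrder_apply, Complex.inner, ← Complex.normSq_eq_norm_sq, Complex.normSq_apply]
    simp
    ring
  have h2 : y.re ^ 2 ≤ ‖y‖ ^ 2 := by
    rw [← Complex.normSq_eq_norm_sq, Complex.normSq_apply]
    nlinarith [mul_self_nonneg y.im]
  rw [h1]
  exact ⟨by positivity, by nlinarith⟩

instance nontrivial_Cn [NeZero n] : Nontrivial (Cn n) := by
  unfold Cn
  infer_instance

lemma eventuallyEq_of_eqOn_ball {E F : Type*} [SeminormedAddCommGroup E] {u v : E → F} {R : ℝ}
    (h : EqOn u v (ball 0 R)) {z : E} (hz : ‖z‖ < R) : u =ᶠ[𝓝 z] v :=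
  h.eventuallyEq_of_mem (isOpen_ball.mem_nhds (mem_ball_zero_iff.2 hz))

theorem integralMean_normD_sq_mul_le [NeZero n] {p : ℝ} (hp : 2 ≤ p) {ω : ℝ → ℝ}
    (hω : IsMajorant ω) {τ η : ℝ} (hτ : 0 ≤ τ) (hη : 0 ≤ η) {f : Cn n → ℂ}
    (hf : ContDiffOn ℝ 2 f (unitBall n))
    (hpde : ∀ z ∈ unitBall n,
      Laplacian.laplacian f z = (τ : ℂ) * f z + (η : ℂ) * ((f z).re : ℂ))
    {M : ℝ} (hM : 0 < M)
    (hD2 : ∀ r ∈ Ioo (0 : ℝ) 1, integralMean p r (normD2 f) ≤ M * ω (1 / (1 - r)))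
    {r : ℝ} (hr : r ∈ Ioo (0 : ℝ) 1) :
    integralMean p r (normD f) ^ 2 * (1 - p * (η + τ) / (4 * n)) ≤
      normD f 0 ^ 2 + (2 * p * (2 * p - 3) * M ^ 2 * ω 1) *
        ∫ t in (0 : ℝ)..1, ω (1 / (1 - r * t)) := by
  have hp0 : 0 < p := by linarith
  have hn : (0 : ℝ) < n := by exact_mod_cast Nat.pos_of_ne_zero (NeZero.ne n)
  -- A radius strictly between `r` and `1`: `f` is replaced by a globally `C²` function equal to it
  -- on the ball of radius `R`.
  set R := (1 + r) / 2 with hR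
  have hrR : r < R := by linarith [hr.2]
  have hR1 : R < 1 := by linarith [hr.2]
  obtain ⟨u, hu, huf⟩ := exists_contDiff_eqOn_ball (m := 2) (by linarith [hr.1] : 0 < R) hR1 hf
  have hu : ContDiff ℝ 2 u := hu
  have hev : ∀ z, ‖z‖ < R → u =ᶠ[𝓝 z] f := fun z hz => eventuallyEq_of_eqOn_ball huf hz
  have hmain := sphMean_gradSq_le (realBasis n) volume hu hr.1 hrR hp (add_nonneg hη hτ)
    (inner_zerothOrder hτ hη) (fun z hz => by
      have hz1 : z ∈ unitBall n := mem_ball_zero_iff.2 (hz.trans hR1)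
      rw [← laplacian_eq_lap hu, zerothOrder_apply,
        (InnerProductSpace.laplacian_congr_nhds (hev z hz)).eq_of_nhds, hpde z hz1,
        huf (mem_ball_zero_iff.2 hz)])
  have hD : ∀ s, integralMean p s (normD u) ^ 2 = (1 / 2) *
      sphMean (normSphere volume) (fun z => gradSq (realBasis n) u z ^ (p / 2)) s ^ (2 / p) :=
    fun s => integralMean_sq_eq hp0 s (by norm_num) (gradSq_nonneg _ _) (normD_sq u)
  have hH0 : ∀ z, 0 ≤ hessSq (realBasis n) u z := fun z =>
    Finset.sum_nonneg fun _ _ => Finset.sum_nonneg fun _ _ => sq_nonneg _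
  have hH : ∀ s, integralMean p s (normD2 u) ^ 2 = (1 / 4) *
      sphMean (normSphere volume) (fun z => hessSq (realBasis n) u z ^ (p / 2)) s ^ (2 / p) :=
    fun s => integralMean_sq_eq hp0 s (by norm_num) hH0 (normD2_sq hu)
  have hDf : integralMean p r (normD u) = integralMean p r (normD f) :=
    integralMean_congr hr.1.le fun z hz => normD_congr (hev z (by rw [hz]; exact hrR))
  have hD0 : gradSq (realBasis n) u 0 = 2 * normD f 0 ^ 2 := by
    rw [← normD_congr (hev 0 (by rw [norm_zero]; linarith [hr.1])), normD_sq]; ring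
  set K : ℝ → ℝ := fun s =>
    sphMean (normSphere volume) (fun z => hessSq (realBasis n) u z ^ (p / 2)) s ^ (2 / p) with hKdef
  have hKcont : Continuous K := by
    have hc : Continuous (hessSq (realBasis n) u) := continuous_finsetSum _ fun j _ =>
      continuous_gradSq (realBasis n) (contDiff_fderiv_const hu (realBasis n j))
    exact (continuous_sphMean _ (hc.rpow_const fun _ => Or.inr (by positivity))).rpow_const
      fun _ => Or.inr (by positivity)
  have hKle : ∀ s ∈ Ioo 0 r, K s ≤ 4 * (M ^ 2 * ω (1 / (1 - s)) ^ 2) := fun s hs => by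
    have h1 : integralMean p s (normD2 u) ≤ M * ω (1 / (1 - s)) := by
      rw [integralMean_congr hs.1.le fun z hz =>
        normD2_congr (hev z (by rw [hz]; exact hs.2.trans hrR))]
      exact hD2 s ⟨hs.1, hs.2.trans hr.2⟩
    have h2 := pow_le_pow_left₀ (integralMean_nonneg p s (normD2 u)) h1 2
    rw [hH s] at h2
    change 1 / 4 * K s ≤ _ at h2
    rw [mul_pow] at h2
    linarith
  have hωc := hω.continuousOn_comp hr.2
  have hint : ∫ s in (0 : ℝ)..r, (r - s) * K s ≤
      4 * M ^ 2 * ω 1 * ∫ t in (0 : ℝ)..1, ω (1 / (1 - r * t)) := by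
    calc ∫ s in (0 : ℝ)..r, (r - s) * K s
        ≤ ∫ s in (0 : ℝ)..r, 4 * M ^ 2 * ω 1 * ω (1 / (1 - s)) := by
          refine intervalIntegral.integral_mono_on_of_le_Ioo hr.1.le
            (Continuous.intervalIntegrable (by fun_prop) _ _)
            ((continuousOn_const.mul hωc).intervalIntegrable_of_Icc hr.1.le) fun s hs => ?_
          have h1 := hω.sub_mul_sq_le hr.2 ⟨hs.1.le, hs.2.le⟩
          calc (r - s) * K s ≤ (r - s) * (4 * (M ^ 2 * ω (1 / (1 - s)) ^ 2)) :=
                mul_le_mul_of_nonneg_left (hKle s hs) (by linarith [hs.2])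
            _ = 4 * M ^ 2 * ((r - s) * ω (1 / (1 - s)) ^ 2) := by ring
            _ ≤ 4 * M ^ 2 * (ω 1 * ω (1 / (1 - s))) := by gcongr
            _ = _ := by ring
      _ = 4 * M ^ 2 * ω 1 * (r * ∫ t in (0 : ℝ)..1, ω (1 / (1 - r * t))) := by
          rw [intervalIntegral.integral_const_mul, IsMajorant.integral_comp_mul]
      _ ≤ _ := by
          have h1 := hω.integral_nonneg_comp hr
          have h2 := hω.nonneg 1 zero_le_one
          gcongr
          exact mul_le_of_le_one_left h1 hr.2.le
  set I := ∫ t in (0 : ℝ)..1, ω (1 / (1 - r * t)) with hI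
  have hI0 : 0 ≤ I := hω.integral_nonneg_comp hr
  have hω1 : 0 ≤ ω 1 := hω.nonneg 1 zero_le_one
  have hX : sphMean (normSphere volume) (fun z => gradSq (realBasis n) u z ^ (p / 2)) r ^ (2 / p) =
      2 * integralMean p r (normD f) ^ 2 := by
    rw [← hDf, hD r]; ring
  rw [hX, hD0, finrank_Cn] at hmain
  set X := integralMean p r (normD f) ^ 2 with hXdef
  have hX0 : 0 ≤ X := sq_nonneg _
  have hfac : 1 - p * (η + τ) / (4 * n) ≤
      1 - p * (η + τ) * r ^ 2 / (2 * ((2 * n : ℕ) : ℝ)) := by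
    have h1 : p * (η + τ) * r ^ 2 ≤ p * (η + τ) :=
      mul_le_of_le_one_right (mul_nonneg hp0.le (add_nonneg hη hτ)) (pow_le_one₀ hr.1.le hr.2.le)
    have h2 : p * (η + τ) * r ^ 2 / (2 * ((2 * n : ℕ) : ℝ)) ≤ p * (η + τ) / (4 * n) := by
      rw [show (2 * ((2 * n : ℕ) : ℝ)) = 4 * n by push_cast; ring]
      gcongr
    linarith
  have hpp : 0 ≤ p * (p - 1) := by nlinarith
  have h1 := mul_le_mul_of_nonneg_left hint hpp
  have h2 := mul_le_mul_of_nonneg_left hfac hX0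
  -- The argument yields `2p(p-1)`, and `p - 1 ≤ 2p - 3` as `p ≥ 2`. The factor `4` comes from
  -- `normD2_sq`, the `2` on the right from `normD_sq`.
  have h3 : p * (p - 1) * (4 * M ^ 2 * ω 1 * I) ≤
      2 * ((2 * p * (2 * p - 3) * M ^ 2 * ω 1) * I) := by
    have : 0 ≤ M ^ 2 * ω 1 * I := by positivity
    have h4 : 4 * (p * (p - 1)) ≤ 4 * (p * (2 * p - 3)) := by nlinarith
    calc p * (p - 1) * (4 * M ^ 2 * ω 1 * I) = 4 * (p * (p - 1)) * (M ^ 2 * ω 1 * I) := by ring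
      _ ≤ 4 * (p * (2 * p - 3)) * (M ^ 2 * ω 1 * I) := by gcongr
      _ = _ := by ring
  change _ ≤ _ + p * (p - 1) * ∫ s in (0 : ℝ)..r, (r - s) * K s at hmain
  linarith

lemma integrable_norm_rpow {f : Cn n → ℂ} (hf : ContinuousOn f (unitBall n)) {p r : ℝ}
    (hp : 0 ≤ p) (hr : r ∈ Ioo (0 : ℝ) 1) :
    Integrable (fun ζ : sphere (0 : Cn n) 1 => ‖f (r • (ζ : Cn n))‖ ^ p) (sphereMeasure n) := by
  have hc : Continuous fun ζ : sphere (0 : Cn n) 1 => f (r • (ζ : Cn n)) := by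
    refine hf.comp_continuous (by fun_prop) fun ζ => mem_ball_zero_iff.2 ?_
    simp [norm_smul, abs_of_pos hr.1, hr.2]
  have : IsFiniteMeasure (sphereMeasure n) := inferInstanceAs
    (IsFiniteMeasure (((volume : Measure (Cn n)).toSphere univ)⁻¹ • (volume : Measure (Cn n)).toSphere))
  exact integrable_sphere_of_continuous _ (hc.norm.rpow_const fun _ => Or.inr hp)

/-- `sphMean_regPow_growth` bounds the means by the value at the origin and `C` alone, hence
uniformly in `r`, although the `C²` extension used varies with `r`. -/
theorem memGenHardy_of_integralMean_normD_le [NeZero n] {p : ℝ} (hp : 1 ≤ p) {f : Cn n → ℂ}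
    (hf : ContDiffOn ℝ 2 f (unitBall n)) {C : ℝ} (hC : 0 ≤ C)
    (hD : ∀ t ∈ Ioo (0 : ℝ) 1, integralMean p t (normD f) ≤ C / √(1 - t)) : MemGenHardy p f := by
  have hp0 : 0 < p := by linarith
  refine ⟨(continuousOn_iff_continuous_domRestrict.1 hf.continuousOn).measurable,
    fun r hr => integrable_norm_rpow hf.continuousOn hp0.le hr,
    regPow 1 p f 0 ^ (1 / p) + 2 * (√2 * C), ?_⟩
  rintro _ ⟨r, hr, rfl⟩
  simp only
  have hrR : r < (1 + r) / 2 := by linarith [hr.2]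
  obtain ⟨u, hu, huf⟩ := exists_contDiff_eqOn_ball (m := 2) (by linarith [hr.1] : 0 < (1 + r) / 2)
    (by linarith [hr.2] : (1 + r) / 2 < 1) hf
  have hu : ContDiff ℝ 2 u := hu
  have hu1 : ContDiff ℝ 1 u := hu.of_le one_le_two
  have hgrow := sphMean_regPow_growth (realBasis n) (normSphere volume) hu1 hp hr
    (C := √2 * C) (by positivity) fun t ht => by
      have ht1 : t < 1 := ht.2.trans hr.2
      have h1 : integralMean p t (normD u) = integralMean p t (normD f) :=
        integralMean_congr ht.1.le fun z hz =>
          normD_congr (eventuallyEq_of_eqOn_ball huf (by rw [hz]; exact ht.2.trans hrR))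
      have h2 := integralMean_sq_eq hp0 t (by norm_num) (gradSq_nonneg _ _) (normD_sq u)
      set S := sphMean (normSphere volume) (fun z => gradSq (realBasis n) u z ^ (p / 2)) t
      have hS0 : 0 ≤ S := sphMean_nonneg (fun z => Real.rpow_nonneg (gradSq_nonneg _ _ _) _) t
      have h3 : S ^ (1 / p) = √2 * integralMean p t (normD f) := by
        rw [← h1, ← Real.sqrt_sq (integralMean_nonneg p t (normD u)), h2,
          ← Real.sqrt_mul zero_le_two, ← mul_assoc, Real.sqrt_eq_rpow]
        norm_num
        rw [← Real.rpow_mul hS0]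
        congr 1
        ring
      rw [h3, mul_div_assoc]
      exact mul_le_mul_of_nonneg_left (hD t ⟨ht.1, ht1⟩) (Real.sqrt_nonneg 2)
  have hu0 : regPow 1 p u 0 = regPow 1 p f 0 := by
    simp only [regPow]
    rw [huf (mem_ball_self (by linarith [hr.1]))]
  rw [hu0] at hgrow
  refine le_trans ?_ hgrow
  rw [integralMean_congr (h := u) hr.1.le fun z hz =>
    (huf (mem_ball_zero_iff.2 (by rw [hz]; exact hrR))).symm]
  have hV := (contDiff_regPow one_pos p hu1).continuous
  refine Real.rpow_le_rpow (integral_nonneg fun _ => Real.rpow_nonneg (norm_nonneg _) _) ?_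
    (by positivity)
  refine sphMean_le_sphMean (ν := normSphere volume) (f := fun z => ‖u z‖ ^ p)
    (hu.continuous.norm.rpow_const fun _ => Or.inr hp0.le) hV hr.1.le fun z _ => ?_
  rw [regPow, show ‖u z‖ ^ p = (‖u z‖ ^ 2) ^ (p / 2) by
    rw [← Real.rpow_natCast, ← Real.rpow_mul (norm_nonneg _)]; congr 1; push_cast; ring]
  exact Real.rpow_le_rpow (sq_nonneg _) (by linarith) (by positivity)

end Estimates

theorem mainTheorem3 (n : ℕ) (hn : 1 ≤ n) (p : ℝ) (hp : 2 ≤ p)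
    (ω : ℝ → ℝ) (hω : IsMajorant ω)
    (τ η : ℝ) (hτ : 0 ≤ τ) (hη : 0 ≤ η) (hτη : η + τ < 4 * n / p)
    (f : Cn n → ℂ) (hf : ContDiffOn ℝ 2 f (unitBall n))
    (hpde : ∀ z ∈ unitBall n, Laplacian.laplacian f z = (τ : ℂ) * f z + (η : ℂ) * ((f z).re : ℂ))
    (M : ℝ) (hM : 0 < M)
    (hD2 : ∀ r ∈ Set.Ioo (0 : ℝ) 1, integralMean p r (normD2 f) ≤ M * ω (1 / (1 - r))) :
    (∀ r ∈ Set.Ioo (0 : ℝ) 1,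
      integralMean p r (normD f) ≤
        Real.sqrt (1 / (1 - p * (η + τ) / (4 * n))) *
          Real.sqrt (normD f 0 ^ 2 +
            (2 * p * (2 * p - 3) * M ^ 2 * ω 1) * ∫ t in (0 : ℝ)..1, ω (1 / (1 - r * t)))) ∧
    MemGenHardy p f := by
  have : NeZero n := ⟨by omega⟩
  have hp0 : 0 < p := by linarith
  have hn0 : (0 : ℝ) < n := by exact_mod_cast hn
  -- The only use of `η + τ < 4n/p`: the absorbed term leaves a positive coefficient.
  have hq : 0 < 1 - p * (η + τ) / (4 * n) := by
    rw [lt_div_iff₀ hp0] at hτη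
    rw [sub_pos, div_lt_one (by positivity)]
    linarith
  have hB : 0 ≤ 2 * p * (2 * p - 3) * M ^ 2 * ω 1 := by
    have h1 : 0 ≤ 2 * p - 3 := by linarith
    have h2 := hω.nonneg 1 zero_le_one
    positivity
  have hmain : ∀ r ∈ Set.Ioo (0 : ℝ) 1, integralMean p r (normD f) ≤
      Real.sqrt (1 / (1 - p * (η + τ) / (4 * n))) *
        Real.sqrt (normD f 0 ^ 2 +
          (2 * p * (2 * p - 3) * M ^ 2 * ω 1) * ∫ t in (0 : ℝ)..1, ω (1 / (1 - r * t))) := by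
    intro r hr
    have h := integralMean_normD_sq_mul_le hp hω hτ hη hf hpde hM hD2 hr
    rw [← Real.sqrt_mul (by positivity)]
    refine Real.le_sqrt_of_sq_le ?_
    rw [one_div_mul_eq_div, le_div_iff₀ hq]
    exact h
  refine ⟨hmain, ?_⟩
  set B := 2 * p * (2 * p - 3) * M ^ 2 * ω 1
  have hω1 := hω.nonneg 1 zero_le_one
  -- `C` arises by bounding the integral by `ω 1 / (1 - t)` and `normD f 0 ^ 2` by `normD f 0 ^ 2 /
  -- (1 - t)`.
  refine memGenHardy_of_integralMean_normD_le (by linarith) hf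
    (C := √(1 / (1 - p * (η + τ) / (4 * n))) * √(normD f 0 ^ 2 + B * ω 1)) (by positivity)
    fun t ht => (hmain t ht).trans ?_
  have ht1 : 0 < 1 - t := by linarith [ht.2]
  rw [mul_div_assoc √_, ← Real.sqrt_div (by positivity)]
  refine mul_le_mul_of_nonneg_left (Real.sqrt_le_sqrt ?_) (Real.sqrt_nonneg _)
  rw [add_div, mul_div_assoc B]
  refine add_le_add ?_ (mul_le_mul_of_nonneg_left (hω.integral_le_div ht) hB)
  rw [le_div_iff₀ ht1]
  exact mul_le_of_le_one_right (sq_nonneg _) (by linarith [ht.1])
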